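/- **Model space.** Let $F\subseteq\mathbb R$ be a subfield and let $R$ be a finite (not necessarily crystallographic) root system spanning the $F$-vector space $V$, with $\langle\alpha,\beta^\vee\rangle\in F$ for $\alpha,\beta\in R$, spherical Weyl group $\overline W$, basis $B$ and positive roots $R^+$. Let $\Lambda$ be a totally ordered abelian group with a compatible $F$-module structure ($c\lambda\ge 0$ for $0\le c\in F$, $0\le\lambda\in\Lambda$), and let $\mathbb A=V\otimes_F\Lambda$; the functionals $\langle\cdot,\alpha^\vee\rangle$ extend to maps $\mathbb A\to\Lambda$, and $\overline W$ acts on $\mathbb A$. Put $d(x,y)=\sum_{\alpha\in R^+}|\langle y-x,\alpha^\vee\rangle|$. Let $T\neq 0$ be a $\overline W$-invariant subgroup of $\mathbb A$ and $\overline WT=\overline W\ltimes T$ the group of maps $x\mapsto wx+t$. Half-apartments of $\mathbb A$ are the sets $\{x:\langle x,\alpha^\vee\rangle\ge\lambda\}$ with $\alpha\in R$, $\lambda\in\Lambda$; such a half-apartment is special if $\alpha\otimes\lambda\in T$. A subset of $\mathbb A$ is called convex if it is an intersection of finitely many special half-apartments. The fundamental Weyl chamber is $C=\{x:\langle x,\alpha^\vee\rangle\ge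 0\ \forall\alpha\in R^+\}$, and its faces are $C_J=\{x\in C:\langle x,\alpha^\vee\rangle=0\ \forall \alpha\in J\}$ for $J\subseteq B$. Weyl chambers (Weyl simplices) of $\mathbb A$ are the images of $C$ (of the $C_J$) under $\overline W\ltimes\mathbb A$; the Weyl simplex $g(C_{J})$ is a face of $g(C_{J'})$ if $J'\subseteq J$, and a panel is a face of a chamber with $|J|=1$. **Affine buildings.** Let $X$ be a non-empty set and $\mathcal A$ a set of injective maps (charts) $\mathbb A\to X$. The images of charts are the apartments of $X$; Weyl chambers, Weyl simplices, faces, half-apartments of $X$ are the images of those of $\mathbb A$ under charts. Assume that $(X,\mathcal A)$ is a generalized affine building: - (A1) $f\circ w\in\mathcal A$ for all $f\in\mathcal A$, $w\in\overline WT$. - (A2) If $f,g\in\mathcal A$ and $f(\mathbb A)\cap g(\mathbb A)\ne\emptyset$, then $f^{-1}(g(\mathbb A))$ is convex, and $f=g\circ w$ on this set for some $w\in\overline WT$. - (A3) Any two points of $X$ lie in a common apartment. (Hence $d$ induces a well-defined function $d:X\times X\to\Lambda$.) - (A4) Any two Weyl chambers of $X$ contain Weyl chambers that lie in a common apartment.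 - (A5) For each apartment $A$ and $x\in A$ there is a map $r:X\to A$ that is the identity on $A$, does not increase distances, and satisfies $r^{-1}(x)=\{x\}$. - (A6) If three apartments pairwise intersect in half-apartments, then their common intersection is non-empty. **Structure at infinity.** Two subsets $\Omega_1,\Omega_2$ of $X$ are parallel if there is $N\in\Lambda$ such that each point of $\Omega_i$ is at distance at most $N$ from some point of $\Omega_j$, $\{i,j\}=\{1,2\}$. The parallel class $\partial S$ of a Weyl simplex $S$ consists of all Weyl simplices parallel to $S$. Let $\partial X$ be the set of parallel classes of Weyl simplices, where $a$ is a face of $b$ if some member of $a$ is a face of some member of $b$. Its chambers are the classes of Weyl chambers; two chambers are adjacent if they have distinct representatives in a common apartment, with the same base point and a common panel. For an apartment $A$ of $X$ let $\partial A\subseteq\partial X$ be the set of classes that have a member contained in $A$. **Statement.** 1. $\partial X$, with this face relation, is a simplicial complex (with the class of the points of $X$ as its empty simplex), and together with the sets $\partial A$ as apartments it is a spherical building of type $R$. That is, $\overline W$ is finite; each $\partial A$ is a subcomplex isomorphic to the Coxeter complex of $\overline W$ with respect to the reflections in $B$ (cosets $w\overline W_J$ ordered by reverse inclusion); any two simplices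 of $\partial X$ lie in a common $\partial A$; and if $\partial A$ and $\partial A'$ both contain simplices $a$ and $b$, then there is an isomorphism $\partial A\to\partial A'$ that fixes $a$ and $b$ pointwise (i.e. with all their faces). 2. The maximal simplices of $\partial X$ are exactly the classes of Weyl chambers, and two of these are adjacent if and only if they are distinct and have a common face of codimension one. 3. The map $A\mapsto\partial A$ is a bijection from the set of apartments of $X$ onto the set of apartments of $\partial X$. -/

import Mathlib

open scoped TensorProduct

noncomputable section

namespace AffBuilding

section ModelSpace

variable {F : Subfield ℝ} {ι V V' Λ : Type*} [Fintype ι]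
  [AddCommGroup V] [Module F V] [AddCommGroup V'] [Module F V']
  [AddCommGroup Λ] [LinearOrder Λ] [Module F Λ]

/-- The root `α_i` is a combination of the roots indexed by `b` with non-negative coefficients. -/
def IsPositive (P : RootPairing ι F V V') (b : Finset ι) (i : ι) : Prop :=
  ∃ c : ι → F, (∀ j ∈ b, 0 ≤ c j) ∧ P.root i = ∑ j ∈ b, c j • P.root j

/-- `b` indexes a basis (a set of simple roots) of the root system: the simple roots are linearly
independent, and every root is a combination of them with coefficients of one sign. As the root
system need not be crystallographic, the coefficients lie in `F`. -/
structure IsBasis (P : RootPairing ι F V V') (b : Finset ι) : Prop where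
  linearIndepOn : LinearIndepOn F P.root (b : Set ι)
  pos_or_neg : ∀ i, IsPositive P b i ∨
    ∃ c : ι → F, (∀ j ∈ b, 0 ≤ c j) ∧ -P.root i = ∑ j ∈ b, c j • P.root j

/-- The spherical Weyl group: the group of linear maps generated by all reflections. -/
def sphericalWeylGroup (P : RootPairing ι F V V') : Subgroup (V ≃ₗ[F] V) :=
  Subgroup.closure (Set.range P.reflection)

/-- The evaluation `x ↦ ⟨x, α_i^∨⟩` on the model space `V ⊗ Λ`, with
`⟨v ⊗ l, α_i^∨⟩ = ⟨v, α_i^∨⟩ • l`. -/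
def evalCoroot (P : RootPairing ι F V V') (Λ : Type*) [AddCommGroup Λ] [Module F Λ] (i : ι) :
    V ⊗[F] Λ →ₗ[F] Λ :=
  (TensorProduct.lid F Λ).toLinearMap ∘ₗ (P.coroot' i).rTensor Λ

/-- The linear extension of a linear map of `V` to the model space, `v ⊗ l ↦ w v ⊗ l`. -/
def act (w : V ≃ₗ[F] V) : V ⊗[F] Λ →ₗ[F] V ⊗[F] Λ :=
  w.toLinearMap.rTensor Λ

/-- The affine Weyl group with translation group `T`, as a set of self-maps of the model space:
all maps `x ↦ w x + t` with `w` in the spherical Weyl group and `t ∈ T`. -/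
def affineWeylGroup (P : RootPairing ι F V V') (T : AddSubgroup (V ⊗[F] Λ)) :
    Set (V ⊗[F] Λ → V ⊗[F] Λ) :=
  {g | ∃ w ∈ sphericalWeylGroup P, ∃ t ∈ T, ∀ x, g x = act w x + t}

/-- The full affine Weyl group, which contains all translations. -/
def fullAffineWeylGroup (P : RootPairing ι F V V') (Λ : Type*) [AddCommGroup Λ] [Module F Λ] :
    Set (V ⊗[F] Λ → V ⊗[F] Λ) :=
  affineWeylGroup P ⊤

/-- The fundamental Weyl chamber. -/
def fundChamber (P : RootPairing ι F V V') (b : Finset ι) : Set (V ⊗[F] Λ) :=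
  {x | ∀ i, IsPositive P b i → 0 ≤ evalCoroot P Λ i x}

/-- The face of the fundamental Weyl chamber on which the simple coroots in `J` vanish.
`J = ∅` gives the chamber itself, a singleton `J` a panel, and `J = b` the point `0`. -/
def fundFace (P : RootPairing ι F V V') (b J : Finset ι) : Set (V ⊗[F] Λ) :=
  {x ∈ fundChamber P b | ∀ j ∈ J, evalCoroot P Λ j x = 0}

/-- Half-apartments of the model space. Both sides of a hyperplane occur, since the negative of a
root is a root. -/
def IsHalfApartment (P : RootPairing ι F V V') (H : Set (V ⊗[F] Λ)) : Prop :=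
  ∃ (i : ι) (l : Λ), H = {x | l ≤ evalCoroot P Λ i x}

/-- Special half-apartments with respect to `T`. The map `x ↦ r_i x + t` is an affine reflection
iff `t = α_i ⊗ l` for some `l`; its fixed hyperplane is then `{x | ⟨x, α_i^∨⟩ = l}`, and it is in
the affine Weyl group of `T` iff `α_i ⊗ l ∈ T`. -/
def IsSpecialHalfApartment (P : RootPairing ι F V V') (T : AddSubgroup (V ⊗[F] Λ))
    (H : Set (V ⊗[F] Λ)) : Prop :=
  ∃ (i : ι) (l : Λ), P.root i ⊗ₜ[F] l ∈ T ∧ H = {x | l ≤ evalCoroot P Λ i x}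

/-- A set is convex if it is an intersection of finitely many special half-apartments (the
intersection of none being the whole model space). -/
def IsConvex (P : RootPairing ι F V V') (T : AddSubgroup (V ⊗[F] Λ))
    (Y : Set (V ⊗[F] Λ)) : Prop :=
  ∃ 𝓗 : Set (Set (V ⊗[F] Λ)), 𝓗.Finite ∧ (∀ H ∈ 𝓗, IsSpecialHalfApartment P T H) ∧ Y = ⋂₀ 𝓗

open Classical in
/-- The `Λ`-valued metric of the model space: the sum over all positive roots `α` of
`|⟨y - x, α^∨⟩|`. -/
def modelDist (P : RootPairing ι F V V') (b : Finset ι) (x y : V ⊗[F] Λ) : Λ :=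
  ∑ i with IsPositive P b i, |evalCoroot P Λ i (y - x)|

end ModelSpace

section Building

variable {F : Subfield ℝ} {ι V V' Λ X : Type*} [Fintype ι]
  [AddCommGroup V] [Module F V] [AddCommGroup V'] [Module F V']
  [AddCommGroup Λ] [LinearOrder Λ] [Module F Λ]

/-- The apartments of `X`: the images of the charts. -/
def apartments (𝒜 : Set (V ⊗[F] Λ → X)) : Set (Set X) :=
  {A | ∃ f ∈ 𝒜, A = Set.range f}

/-- Weyl chambers of `X`. -/
def IsWeylChamber (P : RootPairing ι F V V') (b : Finset ι) (𝒜 : Set (V ⊗[F] Λ → X))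
    (S : Set X) : Prop :=
  ∃ f ∈ 𝒜, ∃ g ∈ fullAffineWeylGroup P Λ, S = f '' (g '' fundChamber P b)

/-- Weyl simplices of `X`: the faces of Weyl chambers, of all dimensions. -/
def IsWeylSimplex (P : RootPairing ι F V V') (b : Finset ι) (𝒜 : Set (V ⊗[F] Λ → X))
    (S : Set X) : Prop :=
  ∃ f ∈ 𝒜, ∃ g ∈ fullAffineWeylGroup P Λ, ∃ J ⊆ b, S = f '' (g '' fundFace P b J)

/-- The Weyl simplex `S₁` is a face of the Weyl simplex `S₂`. -/
def IsFace (P : RootPairing ι F V V') (b : Finset ι) (𝒜 : Set (V ⊗[F] Λ → X))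
    (S₁ S₂ : Set X) : Prop :=
  ∃ f ∈ 𝒜, ∃ g ∈ fullAffineWeylGroup P Λ, ∃ J₁ ⊆ b, ∃ J₂ ⊆ J₁,
    S₁ = f '' (g '' fundFace P b J₁) ∧ S₂ = f '' (g '' fundFace P b J₂)

/-- Two distinct Weyl chambers in a common apartment with the same base point and a common panel. -/
def AdjacentChambers (P : RootPairing ι F V V') (b : Finset ι) (𝒜 : Set (V ⊗[F] Λ → X))
    (S₁ S₂ : Set X) : Prop :=
  S₁ ≠ S₂ ∧ ∃ f ∈ 𝒜, ∃ g ∈ fullAffineWeylGroup P Λ, ∃ h ∈ fullAffineWeylGroup P Λ,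
    S₁ = f '' (g '' fundChamber P b) ∧ S₂ = f '' (h '' fundChamber P b) ∧ g 0 = h 0 ∧
      ∃ j ∈ b, ∃ k ∈ b, (g '' fundFace P b {j} : Set (V ⊗[F] Λ)) = h '' fundFace P b {k}

/-- Half-apartments of `X`. -/
def IsHalfApartmentOf (P : RootPairing ι F V V') (𝒜 : Set (V ⊗[F] Λ → X)) (H : Set X) : Prop :=
  ∃ f ∈ 𝒜, ∃ M, IsHalfApartment P M ∧ H = f '' M

open Classical in
/-- The distance of two points of `X`: the distance of their preimages under a chart whose image
contains both. In an affine building such a chart exists, and the value does not depend on it. -/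
def dist (P : RootPairing ι F V V') (b : Finset ι) (𝒜 : Set (V ⊗[F] Λ → X)) (x y : X) : Λ :=
  if h : ∃ d : Λ, ∃ f ∈ 𝒜, ∃ p q, f p = x ∧ f q = y ∧ d = modelDist P b p q then h.choose else 0

/-- Generalized affine buildings with atlas `𝒜`, modelled on `V ⊗ Λ` with the affine Weyl group
of `T`. -/
structure IsAffineBuilding (P : RootPairing ι F V V') (b : Finset ι) (T : AddSubgroup (V ⊗[F] Λ))
    (𝒜 : Set (V ⊗[F] Λ → X)) : Prop where
  injective : ∀ f ∈ 𝒜, Function.Injective f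
  A1 : ∀ f ∈ 𝒜, ∀ w ∈ affineWeylGroup P T, f ∘ w ∈ 𝒜
  A2 : ∀ f ∈ 𝒜, ∀ g ∈ 𝒜, (Set.range f ∩ Set.range g).Nonempty →
    IsConvex P T (f ⁻¹' Set.range g) ∧
      ∃ w ∈ affineWeylGroup P T, ∀ x ∈ f ⁻¹' Set.range g, f x = g (w x)
  A3 : ∀ x y : X, ∃ f ∈ 𝒜, x ∈ Set.range f ∧ y ∈ Set.range f
  A4 : ∀ S₁ S₂, IsWeylChamber P b 𝒜 S₁ → IsWeylChamber P b 𝒜 S₂ →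
    ∃ S₁' S₂', IsWeylChamber P b 𝒜 S₁' ∧ IsWeylChamber P b 𝒜 S₂' ∧ S₁' ⊆ S₁ ∧ S₂' ⊆ S₂ ∧
      ∃ f ∈ 𝒜, S₁' ∪ S₂' ⊆ Set.range f
  A5 : ∀ A ∈ apartments 𝒜, ∀ x ∈ A, ∃ r : X → X, (∀ y, r y ∈ A) ∧ (∀ y ∈ A, r y = y) ∧
    (∀ y z, dist P b 𝒜 (r y) (r z) ≤ dist P b 𝒜 y z) ∧ r ⁻¹' {x} = {x}
  A6 : ∀ f ∈ 𝒜, ∀ g ∈ 𝒜, ∀ h ∈ 𝒜,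
    IsHalfApartmentOf P 𝒜 (Set.range f ∩ Set.range g) →
    IsHalfApartmentOf P 𝒜 (Set.range g ∩ Set.range h) →
    IsHalfApartmentOf P 𝒜 (Set.range f ∩ Set.range h) →
      (Set.range f ∩ Set.range g ∩ Set.range h).Nonempty

/-- Two subsets of `X` are parallel if they are at bounded distance from each other. -/
def Parallel (P : RootPairing ι F V V') (b : Finset ι) (𝒜 : Set (V ⊗[F] Λ → X))
    (Ω₁ Ω₂ : Set X) : Prop :=
  ∃ N : Λ, (∀ x ∈ Ω₁, ∃ y ∈ Ω₂, dist P b 𝒜 x y ≤ N) ∧ (∀ y ∈ Ω₂, ∃ x ∈ Ω₁, dist P b 𝒜 y x ≤ N)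

/-- The parallel class `∂S` of a Weyl simplex `S`: all Weyl simplices parallel to `S`. -/
def parallelClass (P : RootPairing ι F V V') (b : Finset ι) (𝒜 : Set (V ⊗[F] Λ → X))
    (S : Set X) : Set (Set X) :=
  {S' | IsWeylSimplex P b 𝒜 S' ∧ Parallel P b 𝒜 S S'}

/-- The simplices of `∂X`: the parallel classes of Weyl simplices. The class of the points of `X`
is the empty simplex, and the parallel classes of Weyl chambers are the chambers of `∂X`. -/
def SimplexAtInfinity (P : RootPairing ι F V V') (b : Finset ι) (𝒜 : Set (V ⊗[F] Λ → X)) :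
    Type _ :=
  {K : Set (Set X) // ∃ S, IsWeylSimplex P b 𝒜 S ∧ K = parallelClass P b 𝒜 S}

/-- The face relation of `∂X`: some member of the first class is a face of some member of the
second one. -/
def FaceAtInfinity (P : RootPairing ι F V V') (b : Finset ι) (𝒜 : Set (V ⊗[F] Λ → X))
    (K L : SimplexAtInfinity P b 𝒜) : Prop :=
  ∃ S₁ ∈ K.1, ∃ S₂ ∈ L.1, IsFace P b 𝒜 S₁ S₂

/-- The chambers of `∂X`: the parallel classes of Weyl chambers. -/
def IsChamberAtInfinity (P : RootPairing ι F V V') (b : Finset ι) (𝒜 : Set (V ⊗[F] Λ → X))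
    (K : SimplexAtInfinity P b 𝒜) : Prop :=
  ∃ S, IsWeylChamber P b 𝒜 S ∧ K.1 = parallelClass P b 𝒜 S

/-- Adjacency of chambers of `∂X`: there are representatives in a common apartment which have the
same base point and are adjacent. -/
def AdjacentAtInfinity (P : RootPairing ι F V V') (b : Finset ι) (𝒜 : Set (V ⊗[F] Λ → X))
    (K L : SimplexAtInfinity P b 𝒜) : Prop :=
  ∃ S₁ ∈ K.1, ∃ S₂ ∈ L.1, AdjacentChambers P b 𝒜 S₁ S₂

/-- The subset `∂A` of `∂X` of all parallel classes of Weyl simplices contained in `A`. -/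
def boundary (P : RootPairing ι F V V') (b : Finset ι) (𝒜 : Set (V ⊗[F] Λ → X)) (A : Set X) :
    Set (SimplexAtInfinity P b 𝒜) :=
  {K | ∃ S ∈ K.1, S ⊆ A}

/-- The apartments of `∂X`: the sets `∂A`, where `A` is an apartment of `X`. -/
def apartmentsAtInfinity (P : RootPairing ι F V V') (b : Finset ι) (𝒜 : Set (V ⊗[F] Λ → X)) :
    Set (Set (SimplexAtInfinity P b 𝒜)) :=
  {B | ∃ A ∈ apartments 𝒜, B = boundary P b 𝒜 A}

end Building

section Spherical

variable {F : Subfield ℝ} {ι V V' : Type*}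
  [AddCommGroup V] [Module F V] [AddCommGroup V'] [Module F V']

/-- The simplices of the Coxeter complex of the spherical Weyl group with respect to the simple
reflections: the cosets `w W_J`, where `W_J` is generated by the simple reflections in `J`. -/
def CoxeterSimplex (P : RootPairing ι F V V') (b : Finset ι) : Type _ :=
  {K : Set (V ≃ₗ[F] V) // ∃ w ∈ sphericalWeylGroup P, ∃ J ⊆ b,
    K = (fun u => w * u) '' (Subgroup.closure (P.reflection '' (J : Set ι)) : Set (V ≃ₗ[F] V))}

/-- The face relation of the Coxeter complex is reverse inclusion of cosets. -/
def CoxeterFace (P : RootPairing ι F V V') (b : Finset ι) (K L : CoxeterSimplex P b) : Prop :=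
  L.1 ⊆ K.1

/-- A simplicial complex, as the set of its simplices (the empty one included) with the face
relation: a partial order in which any two elements have a greatest lower bound, and in which the
faces of each simplex form a finite Boolean lattice. -/
structure IsSimplicialComplex {Δ : Type*} (le : Δ → Δ → Prop) : Prop where
  nonempty : Nonempty Δ
  refl : ∀ x, le x x
  trans : ∀ x y z, le x y → le y z → le x z
  antisymm : ∀ x y, le x y → le y x → x = y
  exists_glb : ∀ x y, ∃ z, ∀ u, le u z ↔ le u x ∧ le u y
  boolean : ∀ x, ∃ n : ℕ,
    Nonempty (Subrel le (fun y => le y x) ≃r ((· ⊆ ·) : Finset (Fin n) → Finset (Fin n) → Prop))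

/-- The simplicial complex `Δ` with face relation `le`, together with the set `𝒮` of apartments,
is a spherical building of the type of the root system `P` with simple roots `b`: the Weyl group
is finite, the apartments are subcomplexes isomorphic to its Coxeter complex, any two simplices lie
in a common apartment, and for any two apartments that contain the simplices `x` and `y` there is
an isomorphism between them that fixes `x` and `y` pointwise (that is, with all faces). -/
structure IsSphericalBuilding (P : RootPairing ι F V V') (b : Finset ι) {Δ : Type*}
    (le : Δ → Δ → Prop) (𝒮 : Set (Set Δ)) : Prop where
  spherical : Finite (sphericalWeylGroup P)
  simplicial : IsSimplicialComplex le
  subcomplex : ∀ B ∈ 𝒮, ∀ x ∈ B, ∀ y, le y x → y ∈ B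
  coxeter : ∀ B ∈ 𝒮, Nonempty (Subrel le (· ∈ B) ≃r CoxeterFace P b)
  common_apartment : ∀ x y, ∃ B ∈ 𝒮, x ∈ B ∧ y ∈ B
  exists_iso : ∀ B ∈ 𝒮, ∀ B' ∈ 𝒮, ∀ x ∈ B ∩ B', ∀ y ∈ B ∩ B',
    ∃ φ : Subrel le (· ∈ B) ≃r Subrel le (· ∈ B'),
      ∀ z, le z.1 x ∨ le z.1 y → (φ z).1 = z.1

end Spherical

end AffBuilding

end

noncomputable section

set_option linter.unusedSectionVars false

namespace AffBuilding

/-! ### Root systems: simple roots, coroots and coweights -/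

section RootSystem

variable {F : Subfield ℝ} {ι V V' : Type*} [Fintype ι]
  [AddCommGroup V] [Module F V] [AddCommGroup V'] [Module F V']
  {P : RootPairing ι F V V'} {b : Finset ι}

/-! Simplices at infinity can be compared inside one apartment. In a chart `f`, a Weyl simplex is a
cone `f (w C_J + t)`. Following a ray inside it shows that it stays within bounded distance of the
cone given by `w'`, `J'`, `t'` exactly when `w⁻¹ w' ∈ W_J` and `J' ⊆ J`, that is, when `w' W_J' ⊆ w
W_J` (`dominated_iff`). So base points do not matter for parallelism, the face relation at infinity
is coarse containment, and `∂A` is the Coxeter complex. This rests on the fundamental chamber being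
a strict fundamental domain with parabolic stabilizers (`apply_eq_self_of_dominant`).

By A4 any two Weyl chambers have subchambers in a common apartment, and passing to a subchamber
changes the class of no face (`exists_common_directions`). Hence any two simplices lie in a common
`∂A`, the faces of a simplex can be read off in any apartment containing it, and the axioms of a
simplicial complex reduce to the combinatorics of standard parabolic subgroups.

The hard point is the isomorphism between two apartments at infinity. If they share a chamber,
identifying their cosets relative to it fixes every common simplex, provided that the relative
position of a chamber and a simplex does not depend on the apartment. For two chambers the
transition map between charts gives this. For a chamber and a panel, the distance to points deep
inside a chamber is linear; the triangle inequality, which comes from the retractions of A5, then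
shows that two Weyl translates of the sum of the positive coroots agree on the panel, so they agree
up to one simple reflection (`mem_parabolic_of_parallel_panel`). A gallery argument yields all
simplices (`mem_parabolic_of_parallel`). Without a common chamber, a third apartment containing one
chamber of each serves as intermediary (`exists_iso`).

Finally, `∂A` determines `A`: if `∂A ⊆ ∂A'`, then `A ∩ A'` contains subchambers in all directions of
`A`, and no half-apartment does, so the convex set `A ∩ A'` is all of `A`. -/

lemma rootForm_root_self_pos (P : RootPairing ι F V V') (i : ι) :
    0 < P.RootForm (P.root i) (P.root i) := by
  rw [RootPairing.rootForm_apply_apply]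
  refine Finset.sum_pos' (fun j _ => mul_self_nonneg _) ⟨i, Finset.mem_univ _, ?_⟩
  rw [RootPairing.root_coroot'_eq_pairing, RootPairing.pairing_same]
  norm_num

lemma two_mul_rootForm_root (P : RootPairing ι F V V') (i : ι) (x : V) :
    2 * P.RootForm x (P.root i) = P.coroot' i x * P.RootForm (P.root i) (P.root i) := by
  have h := P.rootForm_reflection_reflection_apply i x (P.root i)
  rw [RootPairing.reflection_apply_self, RootPairing.reflection_apply] at h
  simp only [map_sub, map_neg, map_smul, LinearMap.sub_apply, LinearMap.smul_apply,
    smul_eq_mul] at h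
  linear_combination -h

/-- The root form is invariant under reflections and positive on roots, which forces the usual
formula `2(x, α)/(α, α)`. It carries relations between roots over to coroots without assuming the
root system crystallographic or reduced. -/
lemma coroot'_apply_eq (P : RootPairing ι F V V') (i : ι) (x : V) :
    P.coroot' i x = 2 / P.RootForm (P.root i) (P.root i) * P.RootForm x (P.root i) := by
  have h := rootForm_root_self_pos P i
  field_simp
  linear_combination -two_mul_rootForm_root P i x

lemma eq_zero_of_coroot' (P : RootPairing ι F V V') [P.IsRootSystem] {x : V}
    (h : ∀ i, P.coroot' i x = 0) : x = 0 := by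
  have hx : P.toPerfPair x = 0 := by
    refine LinearMap.ext_on (RootPairing.IsRootSystem.span_coroot_eq_top (P := P)) ?_
    rintro _ ⟨i, rfl⟩
    exact h i
  exact P.toPerfPair.map_eq_zero_iff.1 hx

lemma reflection_eq_of_root_eq_smul (P : RootPairing ι F V V') {i j : ι} {c : F}
    (h : P.root i = c • P.root j) : P.reflection i = P.reflection j := by
  have hc : c ≠ 0 := by
    rintro rfl
    exact P.ne_zero i (by simpa using h)
  have hj := (rootForm_root_self_pos P j).ne'
  ext x
  rw [RootPairing.reflection_apply, RootPairing.reflection_apply, coroot'_apply_eq,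
    coroot'_apply_eq P j, h, smul_smul]
  congr 2
  simp only [map_smul, LinearMap.smul_apply, smul_eq_mul]
  field_simp

/-- The index of the root `-α_i`. -/
def negIndex (P : RootPairing ι F V V') (i : ι) : ι := P.reflectionPerm i i

lemma root_negIndex (P : RootPairing ι F V V') (i : ι) : P.root (negIndex P i) = -P.root i := by
  rw [negIndex, RootPairing.root_reflectionPerm, RootPairing.reflection_apply_self]

lemma coroot'_negIndex (P : RootPairing ι F V V') (i : ι) :
    P.coroot' (negIndex P i) = -P.coroot' i := by
  refine LinearMap.ext fun x => ?_
  rw [coroot'_apply_eq, root_negIndex, LinearMap.neg_apply, coroot'_apply_eq P i]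
  simp

lemma reflection_negIndex (P : RootPairing ι F V V') (i : ι) :
    P.reflection (negIndex P i) = P.reflection i :=
  reflection_eq_of_root_eq_smul P (c := -1) (by rw [root_negIndex, neg_one_smul])

lemma IsBasis.isPositive_or_negIndex (hb : IsBasis P b) (i : ι) :
    IsPositive P b i ∨ IsPositive P b (negIndex P i) := by
  refine (hb.pos_or_neg i).imp_right ?_
  rintro ⟨c, hc, h⟩
  exact ⟨c, hc, by rw [root_negIndex, h]⟩

lemma isPositive_of_mem (P : RootPairing ι F V V') {j : ι} (hj : j ∈ b) : IsPositive P b j := by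
  classical
  refine ⟨fun k => if k = j then 1 else 0, fun k _ => by dsimp only; split_ifs <;> simp, ?_⟩
  simp [hj]

lemma IsBasis.sum_smul_root_inj (hb : IsBasis P b) {c d : ι → F}
    (h : ∑ j ∈ b, c j • P.root j = ∑ j ∈ b, d j • P.root j) : ∀ j ∈ b, c j = d j := by
  have h1 : ∑ j ∈ b, (c j - d j) • P.root j = 0 := by
    simp only [sub_smul, Finset.sum_sub_distrib, h, sub_self]
  intro j hj
  exact sub_eq_zero.1 (linearIndepOn_finset_iff.1 hb.linearIndepOn _ h1 j hj)

lemma IsBasis.not_isPositive_negIndex (hb : IsBasis P b) {i : ι} (h : IsPositive P b i) :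
    ¬ IsPositive P b (negIndex P i) := by
  obtain ⟨c, hc, h⟩ := h
  rintro ⟨d, hd, h'⟩
  rw [root_negIndex, h, ← Finset.sum_neg_distrib] at h'
  simp only [← neg_smul] at h'
  have h2 := hb.sum_smul_root_inj h'
  refine P.ne_zero i ?_
  rw [h]
  refine Finset.sum_eq_zero fun j hj => ?_
  have : c j = 0 := le_antisymm (by have := h2 j hj; have := hd j hj; linarith) (hc j hj)
  rw [this, zero_smul]

/-- Rescaling by squared lengths turns the coefficients of a root into coefficients of its coroot,
with the same signs. -/
lemma IsPositive.exists_coroot' {i : ι} (h : IsPositive P b i) :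
    ∃ d : ι → F, (∀ j ∈ b, 0 ≤ d j) ∧ P.coroot' i = ∑ j ∈ b, d j • P.coroot' j := by
  obtain ⟨c, hc, h⟩ := h
  have hp := rootForm_root_self_pos P
  refine ⟨fun j => c j * P.RootForm (P.root j) (P.root j) / P.RootForm (P.root i) (P.root i),
    fun j hj => div_nonneg (mul_nonneg (hc j hj) (hp j).le) (hp i).le, ?_⟩
  refine LinearMap.ext fun x => ?_
  rw [coroot'_apply_eq]
  have e : P.RootForm x (P.root i) = ∑ j ∈ b, c j * P.RootForm x (P.root j) := by
    rw [h]; simp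
  rw [e, LinearMap.sum_apply, Finset.mul_sum]
  refine Finset.sum_congr rfl fun j _ => ?_
  rw [LinearMap.smul_apply, coroot'_apply_eq P j, smul_eq_mul]
  have := (hp i).ne'
  have := (hp j).ne'
  field_simp

lemma IsBasis.coroot'_eq_zero (hb : IsBasis P b) {x : V}
    (h : ∀ j ∈ b, P.coroot' j x = 0) (i : ι) : P.coroot' i x = 0 := by
  have key : ∀ i, IsPositive P b i → P.coroot' i x = 0 := by
    intro i hi
    obtain ⟨d, -, hd⟩ := hi.exists_coroot'
    rw [hd, LinearMap.sum_apply]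
    exact Finset.sum_eq_zero fun j hj => by rw [LinearMap.smul_apply, h j hj, smul_zero]
  rcases hb.isPositive_or_negIndex i with hi | hi
  · exact key i hi
  · have := key _ hi
    rwa [coroot'_negIndex, LinearMap.neg_apply, neg_eq_zero] at this

lemma IsBasis.span_eq_top [P.IsRootSystem] (hb : IsBasis P b) :
    Submodule.span F (Set.range fun j : b => P.root j) = ⊤ := by
  have hmem : ∀ c : ι → F,
      ∑ j ∈ b, c j • P.root j ∈ Submodule.span F (Set.range fun j : b => P.root j) := fun c =>
    Submodule.sum_mem _ fun j hj => Submodule.smul_mem _ _ (Submodule.subset_span ⟨⟨j, hj⟩, rfl⟩)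
  rw [eq_top_iff, ← RootPairing.IsRootSystem.span_root_eq_top (P := P), Submodule.span_le]
  rintro _ ⟨i, rfl⟩
  rcases hb.pos_or_neg i with ⟨c, -, h⟩ | ⟨c, -, h⟩
  · rw [h]; exact hmem c
  · rw [SetLike.mem_coe, ← neg_mem_iff, h]; exact hmem c

/-- The fundamental coweights: the basis dual to the simple coroots. -/
lemma IsBasis.exists_coweight [P.IsRootSystem] (hb : IsBasis P b) :
    ∃ ω : ι → V, (∀ j ∈ b, P.coroot' j (ω j) = 1) ∧
      ∀ j ∈ b, ∀ k ∈ b, j ≠ k → P.coroot' j (ω k) = 0 := by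
  classical
  let B : Module.Basis b F V := Module.Basis.mk (v := fun j : b => P.root j)
    hb.linearIndepOn hb.span_eq_top.ge
  have : FiniteDimensional F V := Module.Basis.finiteDimensional_of_finite B
  let φ : V →ₗ[F] (b → F) := LinearMap.pi fun j => P.coroot' j
  have hinj : Function.Injective φ := by
    rw [← LinearMap.ker_eq_bot, LinearMap.ker_eq_bot']
    intro x hx
    exact eq_zero_of_coroot' P (hb.coroot'_eq_zero fun j hj => congrFun hx ⟨j, hj⟩)
  -- The simple roots form a basis, so source and target have the same dimension and injectivity
  -- suffices.
  have hsurj : Function.Surjective φ := by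
    refine (LinearMap.injective_iff_surjective_of_finrank_eq_finrank ?_).1 hinj
    rw [Module.finrank_eq_card_basis B, Module.finrank_fintype_fun_eq_card]
  choose ψ hψ using fun k : ι => hsurj fun j => if (j : ι) = k then 1 else 0
  refine ⟨ψ, fun j hj => ?_, fun j hj k _ hjk => ?_⟩
  · exact (congrFun (hψ j) ⟨j, hj⟩).trans (if_pos rfl)
  · exact (congrFun (hψ k) ⟨j, hj⟩).trans (if_neg hjk)

/-- The fundamental coweights: the basis dual to the simple coroots. -/
def coweight [P.IsRootSystem] (hb : IsBasis P b) : ι → V := hb.exists_coweight.choose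

lemma coroot'_coweight_self [P.IsRootSystem] (hb : IsBasis P b) {j : ι} (hj : j ∈ b) :
    P.coroot' j (coweight hb j) = 1 := hb.exists_coweight.choose_spec.1 j hj

lemma coroot'_coweight_of_ne [P.IsRootSystem] (hb : IsBasis P b) {j k : ι} (hj : j ∈ b)
    (hk : k ∈ b) (h : j ≠ k) : P.coroot' j (coweight hb k) = 0 :=
  hb.exists_coweight.choose_spec.2 j hj k hk h

lemma coroot'_sum_coweight [P.IsRootSystem] (hb : IsBasis P b) {K : Finset ι} (hK : K ⊆ b)
    (c : ι → F) {j : ι} (hj : j ∈ b) [Decidable (j ∈ K)] :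
    P.coroot' j (∑ k ∈ K, c k • coweight hb k) = if j ∈ K then c j else 0 := by
  classical
  rw [map_sum]
  have : ∀ k ∈ K, P.coroot' j (c k • coweight hb k) = if j = k then c k else 0 := by
    intro k hk
    rw [map_smul]
    split_ifs with h
    · subst h; rw [coroot'_coweight_self hb hj, smul_eq_mul, mul_one]
    · rw [coroot'_coweight_of_ne hb hj (hK hk) h, smul_zero]
  rw [Finset.sum_congr rfl this, Finset.sum_ite_eq]
  congr

lemma eq_sum_coweight [P.IsRootSystem] (hb : IsBasis P b) (x : V) :
    x = ∑ k ∈ b, P.coroot' k x • coweight hb k := by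
  classical
  rw [← sub_eq_zero]
  refine eq_zero_of_coroot' P (hb.coroot'_eq_zero fun j hj => ?_)
  rw [map_sub, coroot'_sum_coweight hb subset_rfl _ hj, if_pos hj, sub_self]

/-- The simple reflection `s_j` keeps all positive roots positive, except for multiples of
`α_j`. -/
lemma IsBasis.exists_smul_of_reflectionPerm (hb : IsBasis P b) {i j : ι} (hj : j ∈ b)
    (hi : IsPositive P b i) (hn : ¬ IsPositive P b (P.reflectionPerm j i)) :
    ∃ c : F, P.root i = c • P.root j := by
  classical
  obtain ⟨c, hc, h⟩ := hi
  rcases hb.pos_or_neg (P.reflectionPerm j i) with h' | ⟨d, hd, h'⟩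
  · exact absurd h' hn
  rw [RootPairing.root_reflectionPerm, RootPairing.reflection_apply] at h'
  set m := P.coroot' j (P.root i)
  have e : ∑ k ∈ b, d k • P.root k
      = ∑ k ∈ b, ((if k = j then m else 0) - c k) • P.root k := by
    rw [← h', h]
    simp [sub_smul, Finset.sum_sub_distrib, hj]
  -- The reflection changes only the coefficient at `j`. If the image is negative, every other
  -- coefficient is both non-negative and non-positive.
  have e2 := hb.sum_smul_root_inj e
  refine ⟨c j, ?_⟩
  rw [h]
  refine Finset.sum_eq_single_of_mem j hj fun k hk hkj => ?_
  have h3 := e2 k hk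
  rw [if_neg hkj] at h3
  have : c k = 0 := le_antisymm (by have := hd k hk; linarith) (hc k hk)
  rw [this, zero_smul]

/-- The parabolic subgroup generated by the reflections in `J`. -/
def parabolic (P : RootPairing ι F V V') (J : Finset ι) : Subgroup (V ≃ₗ[F] V) :=
  Subgroup.closure (P.reflection '' (J : Set ι))

lemma reflection_mem_parabolic (P : RootPairing ι F V V') {J : Finset ι} {j : ι} (hj : j ∈ J) :
    P.reflection j ∈ parabolic P J := Subgroup.subset_closure ⟨j, hj, rfl⟩

lemma parabolic_mono (P : RootPairing ι F V V') {J K : Finset ι} (h : J ⊆ K) :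
    parabolic P J ≤ parabolic P K :=
  Subgroup.closure_mono (Set.image_mono (by exact_mod_cast h))

lemma parabolic_empty (P : RootPairing ι F V V') : parabolic P ∅ = ⊥ := by
  simp [parabolic]

lemma reflection_mem (P : RootPairing ι F V V') (i : ι) :
    P.reflection i ∈ sphericalWeylGroup P := Subgroup.subset_closure ⟨i, rfl⟩

lemma parabolic_le (P : RootPairing ι F V V') (J : Finset ι) :
    parabolic P J ≤ sphericalWeylGroup P :=
  Subgroup.closure_mono (Set.image_subset_range _ _)

/-- Elements of the Weyl group permute roots and coroots. -/
lemma exists_perm_of_mem (P : RootPairing ι F V V') {w : V ≃ₗ[F] V}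
    (hw : w ∈ sphericalWeylGroup P) : ∃ σ : Equiv.Perm ι,
      (∀ i, P.root (σ i) = w (P.root i)) ∧ ∀ i x, P.coroot' (σ i) (w x) = P.coroot' i x := by
  induction hw using Subgroup.closure_induction with
  | mem w hw =>
    obtain ⟨j, rfl⟩ := hw
    exact ⟨P.reflectionPerm j, fun i => P.root_reflectionPerm j i, fun i x => by
      rw [RootPairing.coroot'_reflection, RootPairing.reflectionPerm_self]⟩
  | one => exact ⟨1, fun _ => rfl, fun _ _ => rfl⟩
  | mul u w _ _ hu hw =>
    obtain ⟨σ, h1, h2⟩ := hu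
    obtain ⟨τ, h3, h4⟩ := hw
    exact ⟨σ * τ, fun i => by simp [h1, h3], fun i x => by simp [h2, h4]⟩
  | inv w _ hw =>
    obtain ⟨σ, h1, h2⟩ := hw
    refine ⟨σ⁻¹, fun i => ?_, fun i x => ?_⟩
    · apply w.injective
      rw [← h1]; simp
    · rw [← h2]; simp

/-- The permutation of the roots that an element of the Weyl group induces. -/
def rootPerm {w : V ≃ₗ[F] V} (hw : w ∈ sphericalWeylGroup P) : Equiv.Perm ι :=
  (exists_perm_of_mem P hw).choose

lemma root_rootPerm {w : V ≃ₗ[F] V} (hw : w ∈ sphericalWeylGroup P) (i : ι) :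
    P.root (rootPerm hw i) = w (P.root i) := (exists_perm_of_mem P hw).choose_spec.1 i

lemma coroot'_rootPerm {w : V ≃ₗ[F] V} (hw : w ∈ sphericalWeylGroup P) (i : ι) (x : V) :
    P.coroot' (rootPerm hw i) (w x) = P.coroot' i x :=
  (exists_perm_of_mem P hw).choose_spec.2 i x

lemma mul_reflection_mul_inv {w : V ≃ₗ[F] V} (hw : w ∈ sphericalWeylGroup P) (i : ι) :
    w * P.reflection i * w⁻¹ = P.reflection (rootPerm hw i) := by
  rw [mul_inv_eq_iff_eq_mul]
  ext x
  simp only [LinearEquiv.mul_apply, RootPairing.reflection_apply, map_sub, map_smul,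
    coroot'_rootPerm, root_rootPerm]

lemma finite_sphericalWeylGroup (P : RootPairing ι F V V') [P.IsRootSystem] :
    Finite (sphericalWeylGroup P) := by
  refine Finite.of_injective (fun w : sphericalWeylGroup P => rootPerm w.2) ?_
  rintro ⟨u, hu⟩ ⟨w, hw⟩ h
  ext1
  refine LinearEquiv.toLinearMap_injective
    (LinearMap.ext_on (RootPairing.IsRootSystem.span_root_eq_top (P := P)) ?_)
  rintro _ ⟨i, rfl⟩
  have : rootPerm hu i = rootPerm hw i := congrFun (congrArg _ h) i
  simp only [LinearEquiv.coe_coe]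
  rw [← root_rootPerm hu, this, root_rootPerm]

end RootSystem

/-! ### The Weyl group: exchange, fundamental domain, parabolic subgroups -/

section WeylGroup

variable {F : Subfield ℝ} {ι V V' : Type*} [Fintype ι]
  [AddCommGroup V] [Module F V] [AddCommGroup V'] [Module F V']
  {P : RootPairing ι F V V'} {b : Finset ι}

/-- The product of the reflections with indices in a list. -/
def word (P : RootPairing ι F V V') (l : List ι) : V ≃ₗ[F] V := (l.map P.reflection).prod

lemma word_cons (P : RootPairing ι F V V') (i : ι) (l : List ι) :
    word P (i :: l) = P.reflection i * word P l := by
  simp [word]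

lemma word_concat (P : RootPairing ι F V V') (i : ι) (l : List ι) :
    word P (l ++ [i]) = word P l * P.reflection i := by
  simp [word]

lemma word_mem (P : RootPairing ι F V V') (l : List ι) : word P l ∈ sphericalWeylGroup P := by
  refine Subgroup.list_prod_mem _ fun w hw => ?_
  obtain ⟨i, -, rfl⟩ := List.mem_map.1 hw
  exact reflection_mem P i

lemma reflection_mul_self (P : RootPairing ι F V V') (i : ι) :
    P.reflection i * P.reflection i = 1 := by
  rw [← sq, RootPairing.reflection_sq]

lemma exists_word_of_mem_parabolic {w : V ≃ₗ[F] V} (hw : w ∈ parabolic P b) :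
    ∃ l : List ι, (∀ i ∈ l, i ∈ b) ∧ word P l = w := by
  have concat : ∀ u : V ≃ₗ[F] V, ∀ s ∈ P.reflection '' (b : Set ι),
      (∃ l : List ι, (∀ i ∈ l, i ∈ b) ∧ word P l = u) →
        ∃ l : List ι, (∀ i ∈ l, i ∈ b) ∧ word P l = u * s := by
    rintro u _ ⟨i, hi, rfl⟩ ⟨l, hl, rfl⟩
    refine ⟨l ++ [i], fun k hk => ?_, word_concat P i l⟩
    rcases List.mem_append.1 hk with hk | hk
    · exact hl k hk
    · rw [List.mem_singleton.1 hk]; exact hi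
  induction hw using Subgroup.closure_induction_right with
  | one => exact ⟨[], by simp, rfl⟩
  | mul_right u _ s hs h => exact concat u s hs h
  | mul_inv_cancel u _ s hs h =>
    obtain ⟨i, hi, rfl⟩ := hs
    rw [RootPairing.reflection_inv]
    exact concat u _ ⟨i, hi, rfl⟩ h

/-- The exchange condition. -/
lemma IsBasis.exchange (hb : IsBasis P b) {j : ι} (hj : j ∈ b) (l : List ι)
    (hl : ∀ i ∈ l, i ∈ b) (h : ¬ IsPositive P b (rootPerm (word_mem P l) j)) :
    ∃ l' : List ι, (∀ i ∈ l', i ∈ b) ∧ l'.length < l.length ∧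
      word P l' = word P l * P.reflection j := by
  induction l with
  | nil =>
    refine absurd ?_ h
    have : rootPerm (word_mem P []) j = j := P.root.injective (by rw [root_rootPerm]; rfl)
    rw [this]
    exact isPositive_of_mem P hj
  | cons i l ih =>
    have hi : i ∈ b := hl i List.mem_cons_self
    have hl0 : ∀ k ∈ l, k ∈ b := fun k hk => hl k (List.mem_cons_of_mem _ hk)
    -- Somewhere along the word, read from the right, `α_j` turns from positive to negative. If this
    -- happens at the letter `i`, the root reached just before is a multiple of `α_i`, so
    -- conjugation turns `s_j` into `s_i` and that letter cancels.
    by_cases hp : IsPositive P b (rootPerm (word_mem P l) j)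
    · have e : rootPerm (word_mem P (i :: l)) j
          = P.reflectionPerm i (rootPerm (word_mem P l) j) := P.root.injective (by
        rw [root_rootPerm, RootPairing.root_reflectionPerm, root_rootPerm, word_cons]; rfl)
      rw [e] at h
      obtain ⟨c, hc⟩ := hb.exists_smul_of_reflectionPerm hi hp h
      have h1 := reflection_eq_of_root_eq_smul P hc
      rw [← mul_reflection_mul_inv] at h1
      refine ⟨l, hl0, by simp, ?_⟩
      rw [word_cons, ← h1]
      simp only [mul_assoc, inv_mul_cancel_left]
      rw [reflection_mul_self, mul_one]
    · obtain ⟨l', h1, h2, h3⟩ := ih hl0 hp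
      refine ⟨i :: l', ?_, by simpa using h2, by rw [word_cons, word_cons, h3, mul_assoc]⟩
      simpa [hi] using h1

lemma IsBasis.coroot'_nonneg {x : V} (hx : ∀ j ∈ b, 0 ≤ P.coroot' j x) {i : ι}
    (hi : IsPositive P b i) : 0 ≤ P.coroot' i x := by
  obtain ⟨d, hd, h⟩ := hi.exists_coroot'
  rw [h, LinearMap.sum_apply]
  exact Finset.sum_nonneg fun j hj => mul_nonneg (hd j hj) (hx j hj)

lemma reflection_apply_eq_self {x : V} {j : ι} (h : P.coroot' j x = 0) :
    P.reflection j x = x := by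
  rw [RootPairing.reflection_apply, h, zero_smul, sub_zero]

lemma reflection_apply_eq_self_iff {x : V} {j : ι} :
    P.reflection j x = x ↔ P.coroot' j x = 0 := by
  refine ⟨fun h => ?_, reflection_apply_eq_self⟩
  rw [RootPairing.reflection_apply, sub_eq_self, smul_eq_zero] at h
  exact h.resolve_right (P.ne_zero j)

/-- Look at the last letter `j`. If the word sends `α_j` to a positive root, the exchange condition
gives a shorter word for the same element. If it sends `α_j` to a negative root, dominance of `x`
and of its image forces `α_j^∨` to vanish at `x`; then `s_j` fixes `x`, lies in the parabolic
subgroup and can be split off. -/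
lemma word_apply_eq_self_of_dominant (hb : IsBasis P b) {x : V} (hx : ∀ j ∈ b, 0 ≤ P.coroot' j x)
    {J : Finset ι} (hJ : ∀ j ∈ b, P.coroot' j x = 0 → j ∈ J) (n : ℕ) :
    ∀ l : List ι, l.length = n → (∀ i ∈ l, i ∈ b) →
      (∀ j ∈ b, 0 ≤ P.coroot' j (word P l x)) → word P l x = x ∧ word P l ∈ parabolic P J := by
  induction n using Nat.strong_induction_on with
  | _ n ih =>
  intro l hn hl hlx
  rcases List.eq_nil_or_concat' l with rfl | ⟨l, j, rfl⟩
  · exact ⟨rfl, one_mem _⟩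
  rw [List.length_append, List.length_singleton] at hn
  have hj : j ∈ b := hl j (by simp)
  have hl0 : ∀ i ∈ l, i ∈ b := fun i hi => hl i (by simp [hi])
  have e : negIndex P (rootPerm (word_mem P (l ++ [j])) j) = rootPerm (word_mem P l) j := by
    refine P.root.injective ?_
    rw [root_negIndex, root_rootPerm, root_rootPerm, word_concat, LinearEquiv.mul_apply,
      RootPairing.reflection_apply_self, map_neg, neg_neg]
  rcases hb.isPositive_or_negIndex (rootPerm (word_mem P (l ++ [j])) j) with hp | hp
  · have hneg := hb.not_isPositive_negIndex hp
    rw [e] at hneg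
    obtain ⟨l', h1, h2, h3⟩ := hb.exchange hj l hl0 hneg
    rw [word_concat, ← h3] at hlx ⊢
    exact ih l'.length (by omega) l' rfl h1 hlx
  · have h0 := IsBasis.coroot'_nonneg hlx hp
    rw [coroot'_negIndex, LinearMap.neg_apply, coroot'_rootPerm] at h0
    have hz : P.coroot' j x = 0 := le_antisymm (by linarith) (hx j hj)
    have hs := reflection_apply_eq_self hz
    have h1 : word P (l ++ [j]) x = word P l x := by
      rw [word_concat, LinearEquiv.mul_apply, hs]
    rw [h1] at hlx ⊢
    obtain ⟨h2, h3⟩ := ih l.length (by omega) l rfl hl0 hlx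
    refine ⟨h2, ?_⟩
    rw [word_concat]
    exact mul_mem h3 (reflection_mem_parabolic P (hJ j hj hz))

/-- The sum of the positive coroots, as a functional. -/
def posCorootSum (P : RootPairing ι F V V') (b : Finset ι) : V →ₗ[F] F :=
  open Classical in ∑ i with IsPositive P b i, P.coroot' i

/-- It suffices to treat a simple root `α_j`. The reflection `s_j` permutes the positive roots that
are not multiples of `α_j` and negates the values of their coroots at `α_j`, so these cancel. The
positive multiples of `α_j` contribute non-negatively, and `α_j` itself contributes `2`. -/
lemma posCorootSum_pos (hb : IsBasis P b) {i : ι} (hi : IsPositive P b i) :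
    0 < posCorootSum P b (P.root i) := by
  classical
  have key : ∀ j ∈ b, 0 < posCorootSum P b (P.root j) := by
    intro j hj
    have hsplit : posCorootSum P b (P.root j)
        = ∑ k with (IsPositive P b k ∧ ∃ c : F, P.root k = c • P.root j), P.coroot' k (P.root j)
        + ∑ k with (IsPositive P b k ∧ ¬ ∃ c : F, P.root k = c • P.root j),
            P.coroot' k (P.root j) := by
      rw [posCorootSum, LinearMap.sum_apply, ← Finset.filter_filter, ← Finset.filter_filter,
        Finset.sum_filter_add_sum_filter_not]
    have hzero : ∑ k with (IsPositive P b k ∧ ¬ ∃ c : F, P.root k = c • P.root j),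
        P.coroot' k (P.root j) = 0 := by
      have hmaps : ∀ k ∈ Finset.univ.filter
          (fun k => IsPositive P b k ∧ ¬ ∃ c : F, P.root k = c • P.root j),
          P.reflectionPerm j k ∈ Finset.univ.filter
            (fun k => IsPositive P b k ∧ ¬ ∃ c : F, P.root k = c • P.root j) := by
        intro k hk
        obtain ⟨-, hk, hne⟩ := Finset.mem_filter.1 hk
        refine Finset.mem_filter.2 ⟨Finset.mem_univ _, ?_, ?_⟩
        · by_contra hn
          exact hne (hb.exists_smul_of_reflectionPerm hj hk hn)
        · rintro ⟨c, hc⟩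
          refine hne ⟨-c, ?_⟩
          rw [RootPairing.root_reflectionPerm] at hc
          rw [← P.reflection_same j (P.root k), hc, map_smul, RootPairing.reflection_apply_self,
            smul_neg, neg_smul]
      rw [← self_eq_neg, ← Finset.sum_neg_distrib]
      refine Finset.sum_nbij' (P.reflectionPerm j) (P.reflectionPerm j) ?_ ?_ ?_ ?_ ?_
      · exact hmaps
      · exact hmaps
      · intro k _; exact P.reflectionPerm_self j k
      · intro k _; exact P.reflectionPerm_self j k
      · intro k _
        rw [RootPairing.coroot'_reflectionPerm, LinearMap.comp_apply, LinearEquiv.coe_coe,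
          RootPairing.reflection_apply_self, map_neg, neg_neg]
    rw [hsplit, hzero, add_zero]
    refine Finset.sum_pos' ?_ ⟨j, ?_, ?_⟩
    · intro k hk
      obtain ⟨-, ⟨d, hd, hk⟩, c, hc⟩ := Finset.mem_filter.1 hk
      have hcj : d j = c := by
        have e : ∑ i ∈ b, d i • P.root i = ∑ i ∈ b, (if i = j then c else 0) • P.root i := by
          rw [← hk, hc]; simp [hj]
        rw [hb.sum_smul_root_inj e j hj, if_pos rfl]
      have e : P.RootForm (P.root j) (P.root k) = d j * P.RootForm (P.root j) (P.root j) := by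
        rw [hc, map_smul, smul_eq_mul, hcj]
      rw [coroot'_apply_eq, e]
      exact mul_nonneg (div_nonneg zero_le_two (rootForm_root_self_pos P k).le)
        (mul_nonneg (hd j hj) (rootForm_root_self_pos P j).le)
    · rw [Finset.mem_filter]
      exact ⟨Finset.mem_univ _, isPositive_of_mem P hj, 1, (one_smul _ _).symm⟩
    · rw [RootPairing.root_coroot'_eq_pairing, RootPairing.pairing_same]; norm_num
  obtain ⟨c, hc, h⟩ := hi
  have hne : ∃ j ∈ b, c j ≠ 0 := by
    by_contra! h0
    refine P.ne_zero i ?_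
    rw [h]
    exact Finset.sum_eq_zero fun j hj => by rw [h0 j hj, zero_smul]
  obtain ⟨j, hj, hcj⟩ := hne
  rw [h, map_sum]
  refine Finset.sum_pos' (fun k hk => ?_) ⟨j, hj, ?_⟩
  · rw [map_smul]; exact mul_nonneg (hc k hk) (key k hk).le
  · rw [map_smul]; exact mul_pos ((hc j hj).lt_of_ne' hcj) (key j hj)

/-- The Weyl group is generated by the simple reflections. -/
lemma parabolic_eq (hb : IsBasis P b) : parabolic P b = sphericalWeylGroup P := by
  classical
  refine le_antisymm (parabolic_le P b) ?_
  rw [sphericalWeylGroup, Subgroup.closure_le]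
  have pos : ∀ i, IsPositive P b i → P.reflection i ∈ parabolic P b := by
    intro i hi
    -- Descent on height, measured by `posCorootSum` since coefficients need not be integers. A
    -- lowest root `α_k` in `s` pairs positively with some simple coroot `α_j^∨`, so `s_j` lowers
    -- its height; by minimality `s_j α_k` is not positive, so `α_k` is a multiple of `α_j`.
    let s : Finset ι := {k | IsPositive P b k ∧
      (P.reflection k ∈ parabolic P b → P.reflection i ∈ parabolic P b)}
    obtain ⟨k, hk, hmin⟩ := s.exists_min_image (fun k => posCorootSum P b (P.root k))
      ⟨i, Finset.mem_filter.2 ⟨Finset.mem_univ _, hi, id⟩⟩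
    obtain ⟨-, hk, himp⟩ := Finset.mem_filter.1 hk
    have hex : ∃ j ∈ b, 0 < P.coroot' j (P.root k) := by
      by_contra! hle
      obtain ⟨d, hd, h⟩ := hk.exists_coroot'
      have h2 : P.coroot' k (P.root k) ≤ 0 := by
        rw [h, LinearMap.sum_apply]
        exact Finset.sum_nonpos fun j hj => mul_nonpos_of_nonneg_of_nonpos (hd j hj) (hle j hj)
      rw [RootPairing.root_coroot'_eq_pairing, RootPairing.pairing_same] at h2
      exact absurd h2 (by norm_num)
    obtain ⟨j, hj, hpos⟩ := hex
    have hsj := reflection_mem_parabolic P hj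
    by_cases hneg : IsPositive P b (P.reflectionPerm j k)
    · have hmem : P.reflectionPerm j k ∈ s := by
        refine Finset.mem_filter.2 ⟨Finset.mem_univ _, hneg, fun h => himp ?_⟩
        rw [RootPairing.reflection_reflectionPerm] at h
        have := mul_mem (mul_mem hsj h) hsj
        rwa [← mul_assoc, ← mul_assoc, reflection_mul_self, one_mul, mul_assoc,
          reflection_mul_self, mul_one] at this
      have := hmin _ hmem
      rw [RootPairing.root_reflectionPerm, RootPairing.reflection_apply, map_sub, map_smul,
        smul_eq_mul] at this
      have := mul_pos hpos (posCorootSum_pos hb (isPositive_of_mem P hj))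
      linarith
    · obtain ⟨c, hc⟩ := hb.exists_smul_of_reflectionPerm hj hk hneg
      refine himp ?_
      rwa [reflection_eq_of_root_eq_smul P hc]
  rintro _ ⟨i, rfl⟩
  rcases hb.isPositive_or_negIndex i with hi | hi
  · exact pos i hi
  · have := pos _ hi
    rwa [reflection_negIndex] at this

/-- The fundamental chamber is a strict fundamental domain, and stabilizers of its points are
parabolic. -/
lemma apply_eq_self_of_dominant (hb : IsBasis P b) {w : V ≃ₗ[F] V} (hw : w ∈ sphericalWeylGroup P)
    {x : V} (hx : ∀ j ∈ b, 0 ≤ P.coroot' j x) (hwx : ∀ j ∈ b, 0 ≤ P.coroot' j (w x))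
    {J : Finset ι} (hJ : ∀ j ∈ b, P.coroot' j x = 0 → j ∈ J) : w x = x ∧ w ∈ parabolic P J := by
  rw [← parabolic_eq hb] at hw
  obtain ⟨l, hl, rfl⟩ := exists_word_of_mem_parabolic hw
  exact word_apply_eq_self_of_dominant hb hx hJ _ l rfl hl hwx

lemma parabolic_apply_eq_self {J : Finset ι} {w : V ≃ₗ[F] V} (hw : w ∈ parabolic P J) {x : V}
    (hx : ∀ j ∈ J, P.coroot' j x = 0) : w x = x := by
  induction hw using Subgroup.closure_induction with
  | mem w hw =>
    obtain ⟨j, hj, rfl⟩ := hw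
    exact reflection_apply_eq_self (hx j hj)
  | one => rfl
  | mul u w _ _ hu hw => rw [LinearEquiv.mul_apply, hw, hu]
  | inv w _ hw =>
    apply w.injective
    rw [hw, ← LinearEquiv.mul_apply, mul_inv_cancel, LinearEquiv.coe_one, id]

variable [P.IsRootSystem]

/-- A point of the fundamental chamber on which exactly the simple coroots in `J` vanish. -/
def facePoint (hb : IsBasis P b) (J : Finset ι) : V :=
  open Classical in ∑ k ∈ b \ J, coweight hb k

lemma coroot'_facePoint_of_mem (hb : IsBasis P b) {J : Finset ι} {j : ι} (hj : j ∈ b)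
    (hJ : j ∈ J) : P.coroot' j (facePoint hb J) = 0 := by
  classical
  have := coroot'_sum_coweight hb (Finset.sdiff_subset (s := b) (t := J)) (fun _ => 1) hj
  simpa [facePoint, hJ] using this

lemma coroot'_facePoint_of_notMem (hb : IsBasis P b) {J : Finset ι} {j : ι} (hj : j ∈ b)
    (hJ : j ∉ J) : P.coroot' j (facePoint hb J) = 1 := by
  classical
  have := coroot'_sum_coweight hb (Finset.sdiff_subset (s := b) (t := J)) (fun _ => 1) hj
  simpa [facePoint, hJ, hj] using this

lemma coroot'_facePoint_nonneg (hb : IsBasis P b) (J : Finset ι) {j : ι} (hj : j ∈ b) :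
    0 ≤ P.coroot' j (facePoint hb J) := by
  by_cases h : j ∈ J
  · rw [coroot'_facePoint_of_mem hb hj h]
  · rw [coroot'_facePoint_of_notMem hb hj h]; exact zero_le_one

lemma mem_of_coroot'_facePoint (hb : IsBasis P b) {J : Finset ι} {j : ι} (hj : j ∈ b)
    (h : P.coroot' j (facePoint hb J) = 0) : j ∈ J := by
  by_contra hJ
  rw [coroot'_facePoint_of_notMem hb hj hJ] at h
  exact one_ne_zero h

lemma mem_parabolic_iff (hb : IsBasis P b) {J : Finset ι} (hJ : J ⊆ b) {w : V ≃ₗ[F] V}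
    (hw : w ∈ sphericalWeylGroup P) :
    w ∈ parabolic P J ↔ w (facePoint hb J) = facePoint hb J := by
  refine ⟨fun h => parabolic_apply_eq_self h fun j hj => coroot'_facePoint_of_mem hb (hJ hj) hj,
    fun h => ?_⟩
  refine (apply_eq_self_of_dominant hb hw (fun j hj => coroot'_facePoint_nonneg hb J hj) ?_
    fun j hj => mem_of_coroot'_facePoint hb hj).2
  rw [h]
  exact fun j hj => coroot'_facePoint_nonneg hb J hj

lemma mem_of_reflection_mem_parabolic (hb : IsBasis P b) {J : Finset ι} (hJ : J ⊆ b) {j : ι}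
    (hj : j ∈ b) (h : P.reflection j ∈ parabolic P J) : j ∈ J := by
  rw [mem_parabolic_iff hb hJ (reflection_mem P j), reflection_apply_eq_self_iff] at h
  exact mem_of_coroot'_facePoint hb hj h

lemma parabolic_le_iff (hb : IsBasis P b) {J K : Finset ι} (hJ : J ⊆ b) (hK : K ⊆ b) :
    parabolic P J ≤ parabolic P K ↔ J ⊆ K :=
  ⟨fun h _ hj => mem_of_reflection_mem_parabolic hb hK (hJ hj)
    (h (reflection_mem_parabolic P hj)), parabolic_mono P⟩

/-- The sum of the two face points is fixed by `w`, and a simple coroot vanishing on it lies in both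
`J` and `K`. -/
lemma mem_parabolic_inter (hb : IsBasis P b) {J K : Finset ι} (hJ : J ⊆ b) (hK : K ⊆ b)
    [DecidableEq ι] {w : V ≃ₗ[F] V} (h1 : w ∈ parabolic P J) (h2 : w ∈ parabolic P K) :
    w ∈ parabolic P (J ∩ K) := by
  have hw := parabolic_le P J h1
  have e : w (facePoint hb J + facePoint hb K) = facePoint hb J + facePoint hb K := by
    rw [map_add, (mem_parabolic_iff hb hJ hw).1 h1, (mem_parabolic_iff hb hK hw).1 h2]
  have hn : ∀ j ∈ b, 0 ≤ P.coroot' j (facePoint hb J + facePoint hb K) := fun j hj => by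
    rw [map_add]
    exact add_nonneg (coroot'_facePoint_nonneg hb J hj) (coroot'_facePoint_nonneg hb K hj)
  refine (apply_eq_self_of_dominant hb hw hn (by rwa [e]) fun j hj h => ?_).2
  rw [map_add] at h
  have h1 := coroot'_facePoint_nonneg hb J hj
  have h2 := coroot'_facePoint_nonneg hb K hj
  exact Finset.mem_inter.2 ⟨mem_of_coroot'_facePoint hb hj (by linarith),
    mem_of_coroot'_facePoint hb hj (by linarith)⟩

lemma eq_one_of_isPositive (hb : IsBasis P b) {w : V ≃ₗ[F] V} (hw : w ∈ sphericalWeylGroup P)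
    (h : ∀ i, IsPositive P b i → IsPositive P b (rootPerm hw i)) : w = 1 := by
  have hx : ∀ j ∈ b, 0 ≤ P.coroot' j (facePoint hb ∅) := fun j hj =>
    coroot'_facePoint_nonneg hb ∅ hj
  rw [← inv_eq_one, ← Subgroup.mem_bot, ← parabolic_empty P]
  have hw' := inv_mem hw
  refine (apply_eq_self_of_dominant hb hw' hx (fun j hj => ?_)
    fun j hj => mem_of_coroot'_facePoint hb hj).2
  have e : P.coroot' j (w⁻¹ (facePoint hb ∅)) = P.coroot' (rootPerm hw j) (facePoint hb ∅) := by
    rw [← coroot'_rootPerm hw, ← LinearEquiv.mul_apply, mul_inv_cancel]; rfl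
  rw [e]
  exact IsBasis.coroot'_nonneg hx (h j (isPositive_of_mem P hj))

/-- The sign of this functional on a root tells whether the root is positive, so an element
preserving the functional preserves the positive roots and is trivial. -/
lemma eq_of_posCorootSum_eq (hb : IsBasis P b) {u w : V ≃ₗ[F] V} (hu : u ∈ sphericalWeylGroup P)
    (hw : w ∈ sphericalWeylGroup P) (h : ∀ x, posCorootSum P b (u x) = posCorootSum P b (w x)) :
    u = w := by
  have hm := mul_mem hu (inv_mem hw)
  refine mul_inv_eq_one.1 (eq_one_of_isPositive hb hm fun i hi => ?_)
  refine (hb.isPositive_or_negIndex _).resolve_right fun hn => ?_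
  have h1 := posCorootSum_pos hb hn
  rw [root_negIndex, root_rootPerm, LinearEquiv.mul_apply, map_neg, h,
    ← LinearEquiv.mul_apply, mul_inv_cancel] at h1
  have h2 := posCorootSum_pos hb hi
  change 0 < -posCorootSum P b (P.root i) at h1
  linarith

/-- If two Weyl group translates of the sum of the positive coroots agree on the wall of a simple
root, then they agree up to the simple reflection. -/
lemma mem_parabolic_of_posCorootSum_eq (hb : IsBasis P b) {u w : V ≃ₗ[F] V}
    (hu : u ∈ sphericalWeylGroup P) (hw : w ∈ sphericalWeylGroup P) {j : ι} (hj : j ∈ b)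
    (h : ∀ k ∈ b, k ≠ j → posCorootSum P b (u (coweight hb k))
      = posCorootSum P b (w (coweight hb k))) :
    u⁻¹ * w ∈ parabolic P {j} := by
  set φ : V →ₗ[F] F := posCorootSum P b ∘ₗ u.toLinearMap with hφ
  set ψ : V →ₗ[F] F := posCorootSum P b ∘ₗ w.toLinearMap with hψ
  -- Both functionals agree on all fundamental coweights except the one at `j`, hence differ by a
  -- multiple of `α_j^∨`.
  obtain ⟨k, hk⟩ : ∃ k : F, ∀ x, φ x = ψ x + k * P.coroot' j x := by
    refine ⟨φ (coweight hb j) - ψ (coweight hb j), fun x => ?_⟩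
    rw [← sub_eq_iff_eq_add', ← LinearMap.sub_apply, ← LinearMap.sub_apply]
    conv_lhs => rw [eq_sum_coweight hb x, map_sum]
    rw [Finset.sum_eq_single_of_mem j hj, map_smul, smul_eq_mul, mul_comm]
    intro i hi hij
    rw [map_smul, LinearMap.sub_apply, hφ, hψ, LinearMap.comp_apply, LinearMap.comp_apply,
      LinearEquiv.coe_coe, LinearEquiv.coe_coe, h i hi hij, sub_self, smul_zero]
  -- The sum of the squared values on all roots is a Weyl invariant quadratic form on functionals.
  -- Equal norms give a quadratic equation for `k` with solutions `0` and `-ψ(α_j)`, which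
  -- correspond to `φ = ψ` and `φ = ψ ∘ s_j`.
  have norm : ∀ {v : V ≃ₗ[F] V} (hv : v ∈ sphericalWeylGroup P),
      ∑ i, (posCorootSum P b (v (P.root i))) ^ 2 = ∑ i, (posCorootSum P b (P.root i)) ^ 2 := by
    intro v hv
    rw [← Equiv.sum_comp (rootPerm hv) fun i => (posCorootSum P b (P.root i)) ^ 2]
    simp only [root_rootPerm]
  have hnorm : ∑ i, (φ (P.root i)) ^ 2 = ∑ i, (ψ (P.root i)) ^ 2 :=
    (norm hu).trans (norm hw).symm
  set Q := ∑ i, (P.coroot' j (P.root i)) ^ 2 with hQ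
  set S := ∑ i, ψ (P.root i) * P.coroot' j (P.root i) with hS
  have hQpos : 0 < Q := by
    refine Finset.sum_pos' (fun i _ => sq_nonneg _) ⟨j, Finset.mem_univ _, ?_⟩
    rw [RootPairing.root_coroot'_eq_pairing, RootPairing.pairing_same]; norm_num
  have e1 : 2 * k * S + k ^ 2 * Q = 0 := by
    have : ∑ i, (φ (P.root i)) ^ 2 = ∑ i, (ψ (P.root i)) ^ 2 + 2 * k * S + k ^ 2 * Q := by
      rw [hQ, hS, Finset.mul_sum, Finset.mul_sum, ← Finset.sum_add_distrib,
        ← Finset.sum_add_distrib]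
      refine Finset.sum_congr rfl fun i _ => ?_
      rw [hk]; ring
    linarith
  -- Reindex the sum over the roots by `s_j`.
  have e2 : 2 * S = ψ (P.root j) * Q := by
    have : S = -S + ψ (P.root j) * Q := by
      conv_lhs => rw [hS, ← Equiv.sum_comp (P.reflectionPerm j)]
      rw [hS, hQ, Finset.mul_sum, ← Finset.sum_neg_distrib, ← Finset.sum_add_distrib]
      refine Finset.sum_congr rfl fun i _ => ?_
      have h2 : P.coroot' j (P.root j) = 2 := by
        rw [RootPairing.root_coroot'_eq_pairing, RootPairing.pairing_same]
      rw [RootPairing.root_reflectionPerm, RootPairing.reflection_apply, map_sub, map_sub,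
        map_smul, map_smul, h2]
      simp only [smul_eq_mul]
      ring
    linarith
  have e3 : k * (ψ (P.root j) + k) = 0 := by
    have : k * (ψ (P.root j) + k) * Q = 0 := by linear_combination e1 - k * e2
    exact (mul_eq_zero.1 this).resolve_right hQpos.ne'
  rcases mul_eq_zero.1 e3 with h0 | h0
  · have : u = w := eq_of_posCorootSum_eq hb hu hw fun x => by
      have := hk x
      rwa [h0, zero_mul, add_zero] at this
    rw [this, inv_mul_cancel]
    exact one_mem _
  · have : u = w * P.reflection j :=
      eq_of_posCorootSum_eq hb hu (mul_mem hw (reflection_mem P j)) fun x => by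
        have h1 := hk x
        have h2 : ψ (P.reflection j x) = ψ x - P.coroot' j x * ψ (P.root j) := by
          rw [RootPairing.reflection_apply, map_sub, map_smul, smul_eq_mul]
        change φ x = ψ (P.reflection j x)
        rw [h1, h2]
        linear_combination P.coroot' j x * h0
    rw [this, mul_inv_rev, RootPairing.reflection_inv, inv_mul_cancel_right]
    exact reflection_mem_parabolic P (Finset.mem_singleton_self j)

end WeylGroup

/-! ### The model space: distance, chambers and coarse containment of cones -/

section Model

variable {F : Subfield ℝ} {ι V V' Λ : Type*} [Fintype ι]
  [AddCommGroup V] [Module F V] [AddCommGroup V'] [Module F V']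
  [AddCommGroup Λ] [LinearOrder Λ] [IsOrderedAddMonoid Λ] [Module F Λ] [PosSMulMono F Λ]
  {P : RootPairing ι F V V'} {b : Finset ι}

lemma evalCoroot_tmul (i : ι) (v : V) (l : Λ) :
    evalCoroot P Λ i (v ⊗ₜ l) = P.coroot' i v • l := by
  simp [evalCoroot]

lemma act_tmul (w : V ≃ₗ[F] V) (v : V) (l : Λ) : act w (v ⊗ₜ[F] l) = w v ⊗ₜ l := by
  simp [act]

lemma act_one (x : V ⊗[F] Λ) : act (1 : V ≃ₗ[F] V) x = x := by
  change LinearMap.rTensor Λ LinearMap.id x = x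
  rw [LinearMap.rTensor_id, LinearMap.id_apply]

lemma act_mul (u w : V ≃ₗ[F] V) (x : V ⊗[F] Λ) : act (u * w) x = act u (act w x) := by
  rw [act, act, act, ← LinearMap.comp_apply, ← LinearMap.rTensor_comp]
  rfl

lemma act_act_inv (w : V ≃ₗ[F] V) (x : V ⊗[F] Λ) : act w (act w⁻¹ x) = x := by
  rw [← act_mul, mul_inv_cancel, act_one]

lemma evalCoroot_act {w : V ≃ₗ[F] V} (hw : w ∈ sphericalWeylGroup P) (i : ι) (x : V ⊗[F] Λ) :
    evalCoroot P Λ (rootPerm hw i) (act w x) = evalCoroot P Λ i x := by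
  induction x with
  | zero => simp
  | add x y hx hy => simp only [map_add, hx, hy]
  | tmul v l => rw [act_tmul, evalCoroot_tmul, evalCoroot_tmul, coroot'_rootPerm]

lemma evalCoroot_negIndex (i : ι) (x : V ⊗[F] Λ) :
    evalCoroot P Λ (negIndex P i) x = -evalCoroot P Λ i x := by
  induction x with
  | zero => simp
  | add x y hx hy => simp only [map_add, hx, hy, neg_add]
  | tmul v l =>
    rw [evalCoroot_tmul, evalCoroot_tmul, coroot'_negIndex, LinearMap.neg_apply, neg_smul]

lemma evalCoroot_nonneg {x : V ⊗[F] Λ} (hx : ∀ j ∈ b, 0 ≤ evalCoroot P Λ j x) {i : ι}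
    (hi : IsPositive P b i) : 0 ≤ evalCoroot P Λ i x := by
  obtain ⟨d, hd, h⟩ := hi.exists_coroot'
  have e : evalCoroot P Λ i x = ∑ j ∈ b, d j • evalCoroot P Λ j x := by
    clear hx
    induction x with
    | zero => simp
    | add x y hx hy => simp only [map_add, hx, hy, smul_add, Finset.sum_add_distrib]
    | tmul v l =>
      simp only [evalCoroot_tmul, h, LinearMap.sum_apply, Finset.sum_smul, LinearMap.smul_apply,
        smul_assoc]
  rw [e]
  exact Finset.sum_nonneg fun j hj => smul_nonneg (hd j hj) (hx j hj)

lemma mem_fundChamber_iff {x : V ⊗[F] Λ} :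
    x ∈ fundChamber P b ↔ ∀ j ∈ b, 0 ≤ evalCoroot P Λ j x :=
  ⟨fun h j hj => h j (isPositive_of_mem P hj), fun h _ hi => evalCoroot_nonneg h hi⟩

lemma fundFace_empty : (fundFace P b ∅ : Set (V ⊗[F] Λ)) = fundChamber P b := by
  ext x; simp [fundFace]

lemma fundFace_anti {J K : Finset ι} (h : J ⊆ K) :
    (fundFace P b K : Set (V ⊗[F] Λ)) ⊆ fundFace P b J :=
  fun _ hx => ⟨hx.1, fun j hj => hx.2 j (h hj)⟩

lemma zero_mem_fundFace (P : RootPairing ι F V V') (b J : Finset ι) :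
    (0 : V ⊗[F] Λ) ∈ fundFace P b J :=
  ⟨mem_fundChamber_iff.2 fun j _ => by rw [map_zero], fun j _ => map_zero _⟩

lemma add_mem_fundChamber {x y : V ⊗[F] Λ} (hx : x ∈ fundChamber P b)
    (hy : y ∈ fundChamber P b) : x + y ∈ fundChamber P b := fun i hi => by
  rw [map_add]; exact add_nonneg (hx i hi) (hy i hi)

lemma tmul_mem_fundFace {J : Finset ι} {v : V} (hv : ∀ j ∈ b, 0 ≤ P.coroot' j v)
    (hJ : ∀ j ∈ J, P.coroot' j v = 0) {l : Λ} (hl : 0 ≤ l) : v ⊗ₜ[F] l ∈ fundFace P b J := by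
  refine ⟨mem_fundChamber_iff.2 fun j hj => ?_, fun j hj => ?_⟩
  · rw [evalCoroot_tmul]; exact smul_nonneg (hv j hj) hl
  · rw [evalCoroot_tmul, hJ j hj, zero_smul]

/-- For negative `c`, scaling by `(-c)⁻¹` produces a value below any given bound. Only division in
`F` is used, so `Λ` may be non-Archimedean. -/
lemma nonneg_of_forall_le_smul [Nontrivial Λ] {c : F} {M : Λ}
    (h : ∀ l : Λ, 0 ≤ l → M ≤ c • l) : 0 ≤ c := by
  by_contra! hc
  obtain ⟨l, hl⟩ := exists_zero_lt (α := Λ)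
  have h1 := h ((-c)⁻¹ • (|M| + l)) (smul_nonneg (inv_nonneg.2 (neg_nonneg.2 hc.le))
    (add_nonneg (abs_nonneg _) hl.le))
  have e : c * (-c)⁻¹ = -1 := by
    have := hc.ne
    field_simp
  rw [smul_smul, e, neg_one_smul, neg_add] at h1
  have h2 := h1.trans_lt (add_lt_of_neg_right _ (neg_lt_zero.2 hl))
  exact h2.not_ge (neg_abs_le M)

lemma eq_zero_of_forall_abs_smul_le [Nontrivial Λ] {c : F} {M : Λ}
    (h : ∀ l : Λ, 0 ≤ l → |c • l| ≤ M) : c = 0 := by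
  refine le_antisymm ?_ (nonneg_of_forall_le_smul fun l hl => (abs_le.1 (h l hl)).1)
  refine neg_nonneg.1 (nonneg_of_forall_le_smul (M := -M) fun l hl => ?_)
  rw [neg_smul]
  exact neg_le_neg (abs_le.1 (h l hl)).2

/-- The sum of the positive coroots, on the model space. -/
def posEval (P : RootPairing ι F V V') (b : Finset ι) : V ⊗[F] Λ →ₗ[F] Λ :=
  open Classical in ∑ i with IsPositive P b i, evalCoroot P Λ i

lemma posEval_tmul (v : V) (l : Λ) : posEval P b (v ⊗ₜ[F] l) = posCorootSum P b v • l := by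
  simp only [posEval, posCorootSum, LinearMap.sum_apply, evalCoroot_tmul, Finset.sum_smul]

/-- On differences in the fundamental chamber the distance is linear. This turns metric estimates
into statements about functionals. -/
lemma modelDist_eq_posEval {x y : V ⊗[F] Λ} (h : y - x ∈ fundChamber P b) :
    modelDist P b x y = posEval P b (y - x) := by
  classical
  rw [modelDist, posEval, LinearMap.sum_apply]
  exact Finset.sum_congr rfl fun i hi => abs_of_nonneg (h i (Finset.mem_filter.1 hi).2)

lemma modelDist_self (x : V ⊗[F] Λ) : modelDist P b x x = 0 := by
  simp [modelDist]

lemma modelDist_comm (x y : V ⊗[F] Λ) : modelDist P b x y = modelDist P b y x := by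
  simp only [modelDist, map_sub, abs_sub_comm]

lemma modelDist_triangle (x y z : V ⊗[F] Λ) :
    modelDist P b x z ≤ modelDist P b x y + modelDist P b y z := by
  rw [modelDist, modelDist, modelDist, ← Finset.sum_add_distrib]
  refine Finset.sum_le_sum fun i _ => ?_
  rw [← sub_add_sub_cancel z y x, map_add, add_comm]
  exact abs_add_le _ _

lemma modelDist_add_right (x y t : V ⊗[F] Λ) :
    modelDist P b (x + t) (y + t) = modelDist P b x y := by
  simp only [modelDist, add_sub_add_right_eq_sub]

lemma modelDist_add_left (x s t : V ⊗[F] Λ) :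
    modelDist P b (x + s) (x + t) = modelDist P b s t := by
  simp only [modelDist, add_sub_add_left_eq_sub]

/-- Pairing each root with its negative makes the sum run over all roots, which the Weyl group
permutes; invariance of the distance follows as `Λ` has no torsion. -/
lemma modelDist_add_self (hb : IsBasis P b) (x y : V ⊗[F] Λ) :
    modelDist P b x y + modelDist P b x y = ∑ i, |evalCoroot P Λ i (y - x)| := by
  classical
  have neg : ∀ i, negIndex P (negIndex P i) = i := fun i => P.root.injective (by
    rw [root_negIndex, root_negIndex, neg_neg])
  rw [← Finset.sum_filter_add_sum_filter_not Finset.univ (IsPositive P b), modelDist]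
  congr 1
  refine Finset.sum_nbij' (negIndex P) (negIndex P) ?_ ?_ ?_ ?_ ?_
  · intro i hi
    rw [Finset.mem_filter] at hi ⊢
    exact ⟨Finset.mem_univ _, hb.not_isPositive_negIndex hi.2⟩
  · intro i hi
    rw [Finset.mem_filter] at hi ⊢
    exact ⟨Finset.mem_univ _, (hb.isPositive_or_negIndex i).resolve_left hi.2⟩
  · exact fun i _ => neg i
  · exact fun i _ => neg i
  · intro i _
    rw [evalCoroot_negIndex, abs_neg]

lemma modelDist_act (hb : IsBasis P b) {w : V ≃ₗ[F] V} (hw : w ∈ sphericalWeylGroup P)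
    (x y : V ⊗[F] Λ) : modelDist P b (act w x) (act w y) = modelDist P b x y := by
  have h : 2 • modelDist P b (act w x) (act w y) = 2 • modelDist P b x y := by
    rw [two_nsmul, two_nsmul, modelDist_add_self hb, modelDist_add_self hb,
      ← Equiv.sum_comp (rootPerm hw)]
    refine Finset.sum_congr rfl fun i _ => ?_
    rw [← map_sub, evalCoroot_act]
  exact nsmul_right_injective two_ne_zero h

lemma abs_evalCoroot_le (hb : IsBasis P b) (i : ι) (x y : V ⊗[F] Λ) :
    |evalCoroot P Λ i (y - x)| ≤ modelDist P b x y := by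
  classical
  have key : ∀ i, IsPositive P b i → |evalCoroot P Λ i (y - x)| ≤ modelDist P b x y := by
    intro i hi
    exact Finset.single_le_sum (f := fun i => |evalCoroot P Λ i (y - x)|)
      (fun _ _ => abs_nonneg _) (Finset.mem_filter.2 ⟨Finset.mem_univ _, hi⟩)
  rcases hb.isPositive_or_negIndex i with hi | hi
  · exact key i hi
  · have := key _ hi
    rwa [evalCoroot_negIndex, abs_neg] at this

variable [P.IsRootSystem]

lemma eq_sum_coweight_tmul (hb : IsBasis P b) (x : V ⊗[F] Λ) :
    x = ∑ k ∈ b, coweight hb k ⊗ₜ evalCoroot P Λ k x := by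
  induction x with
  | zero => simp
  | add x y hx hy =>
    conv_lhs => rw [hx, hy]
    simp only [map_add, TensorProduct.tmul_add, Finset.sum_add_distrib]
  | tmul v l =>
    conv_lhs => rw [eq_sum_coweight hb v, TensorProduct.sum_tmul]
    simp only [evalCoroot_tmul, TensorProduct.smul_tmul]

lemma act_eq_self_of_mem_fundFace (hb : IsBasis P b) {J : Finset ι} (hJ : J ⊆ b)
    {w : V ≃ₗ[F] V} (hw : w ∈ parabolic P J) {x : V ⊗[F] Λ} (hx : x ∈ fundFace P b J) :
    act w x = x := by
  rw [eq_sum_coweight_tmul hb x, map_sum]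
  refine Finset.sum_congr rfl fun k hk => ?_
  rw [act_tmul]
  by_cases hkJ : k ∈ J
  · rw [hx.2 k hkJ, TensorProduct.tmul_zero, TensorProduct.tmul_zero]
  · rw [parabolic_apply_eq_self hw fun j hj => coroot'_coweight_of_ne hb (hJ hj) hk ?_]
    rintro rfl
    exact hkJ hj

lemma exists_add_mem_fundChamber (hb : IsBasis P b) (y z : V ⊗[F] Λ) :
    ∃ u ∈ (fundChamber P b : Set (V ⊗[F] Λ)), u + y ∈ fundChamber P b ∧
      u + z ∈ fundChamber P b := by
  classical
  have heval : ∀ l : ι → Λ, ∀ j ∈ b,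
      evalCoroot P Λ j (∑ k ∈ b, coweight hb k ⊗ₜ l k) = l j := by
    intro l j hj
    rw [map_sum, Finset.sum_eq_single_of_mem j hj, evalCoroot_tmul, coroot'_coweight_self hb hj,
      one_smul]
    intro k hk hkj
    rw [evalCoroot_tmul, coroot'_coweight_of_ne hb hj hk hkj.symm, zero_smul]
  refine ⟨∑ k ∈ b, coweight hb k ⊗ₜ (|evalCoroot P Λ k y| + |evalCoroot P Λ k z|), ?_, ?_, ?_⟩
  all_goals refine mem_fundChamber_iff.2 fun j hj => ?_
  · rw [heval _ j hj]
    exact add_nonneg (abs_nonneg _) (abs_nonneg _)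
  · rw [map_add, heval _ j hj, add_right_comm]
    refine add_nonneg ?_ (abs_nonneg _)
    rw [← neg_le_iff_add_nonneg]
    exact neg_le_abs _
  · rw [map_add, heval _ j hj, add_assoc]
    refine add_nonneg (abs_nonneg _) ?_
    rw [← neg_le_iff_add_nonneg]
    exact neg_le_abs _

/-- Coarse containment of one simplicial cone in another one only depends on the directions. -/
lemma dominated_iff [Nontrivial Λ] (hb : IsBasis P b) {w w' : V ≃ₗ[F] V}
    (hw : w ∈ sphericalWeylGroup P) (hw' : w' ∈ sphericalWeylGroup P) {J J' : Finset ι}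
    (hJ : J ⊆ b) (hJ' : J' ⊆ b) (t t' : V ⊗[F] Λ) :
    (∃ N : Λ, ∀ x ∈ fundFace P b J, ∃ y ∈ fundFace P b J',
      modelDist P b (act w x + t) (act w' y + t') ≤ N) ↔ w⁻¹ * w' ∈ parabolic P J ∧ J' ⊆ J := by
  constructor
  · rintro ⟨N, hN⟩
    have hu := mul_mem (inv_mem hw') hw
    set v := facePoint hb J with hv
    have hv0 : ∀ j ∈ b, 0 ≤ P.coroot' j v := fun j hj => coroot'_facePoint_nonneg hb J hj
    -- Follow the ray through the generic point `v` of the first face, in the coordinates of the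
    -- second cone. The constant `e` absorbs both base points and does not depend on `l`.
    have key : ∀ i, ∃ e : Λ, ∀ l : Λ, 0 ≤ l → ∃ y ∈ fundFace P b J',
        |evalCoroot P Λ i y + e - P.coroot' i ((w'⁻¹ * w) v) • l| ≤ N := by
      intro i
      refine ⟨evalCoroot P Λ (rootPerm hw' i) (t' - t), fun l hl => ?_⟩
      obtain ⟨y, hy, hd⟩ := hN (v ⊗ₜ l) (tmul_mem_fundFace hv0
        (fun j hj => coroot'_facePoint_of_mem hb (hJ hj) hj) hl)
      refine ⟨y, hy, le_trans (le_of_eq ?_)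
        ((abs_evalCoroot_le hb (rootPerm hw' i) _ _).trans hd)⟩
      have e1 : P.coroot' i ((w'⁻¹ * w) v) = P.coroot' (rootPerm hw' i) (w v) := by
        rw [← coroot'_rootPerm hw', ← LinearEquiv.mul_apply, mul_inv_cancel_left]
      rw [e1, ← evalCoroot_tmul, ← act_tmul, ← evalCoroot_act hw' i y, ← map_add, ← map_sub]
      congr 2
      abel
    have hnn : ∀ i ∈ b, 0 ≤ P.coroot' i ((w'⁻¹ * w) v) := by
      intro i hi
      obtain ⟨e, he⟩ := key i
      refine nonneg_of_forall_le_smul (M := e - N) fun l hl => ?_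
      obtain ⟨y, hy, hd⟩ := he l hl
      have h1 := (abs_le.1 hd).2
      have h2 := mem_fundChamber_iff.1 hy.1 i hi
      rw [sub_le_comm] at h1
      refine le_trans ?_ h1
      rw [add_sub_assoc]
      exact le_add_of_nonneg_left h2
    obtain ⟨hfix, hmem⟩ := apply_eq_self_of_dominant hb hu hv0 hnn
      fun j hj => mem_of_coroot'_facePoint hb hj
    refine ⟨by simpa using inv_mem hmem, fun i hi => mem_of_coroot'_facePoint hb (hJ' hi) ?_⟩
    rw [← hv, ← hfix]
    -- Coroots in `J'` vanish on the second face, so they stay bounded along the ray and must vanish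
    -- on its direction.
    refine le_antisymm (neg_nonneg.1 ?_) (hnn i (hJ' hi))
    obtain ⟨e, he⟩ := key i
    refine nonneg_of_forall_le_smul (M := -N - e) fun l hl => ?_
    obtain ⟨y, hy, hd⟩ := he l hl
    have h1 := (abs_le.1 hd).1
    rw [hy.2 i hi, zero_add] at h1
    rw [neg_smul, sub_le_iff_le_add, neg_add_eq_sub]
    exact h1
  · rintro ⟨h, hJJ⟩
    refine ⟨modelDist P b t t', fun x hx => ⟨x, fundFace_anti hJJ hx, le_of_eq ?_⟩⟩
    have : act w' x = act w x := by
      conv_rhs => rw [← act_eq_self_of_mem_fundFace hb hJ h hx, ← act_mul, mul_inv_cancel_left]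
    rw [this, modelDist_add_left]

lemma eq_of_act_eq [Nontrivial Λ] (hb : IsBasis P b) {w w' : V ≃ₗ[F] V}
    (hw : w ∈ sphericalWeylGroup P) (hw' : w' ∈ sphericalWeylGroup P)
    (h : ∀ x ∈ (fundChamber P b : Set (V ⊗[F] Λ)), act w x = act w' x) : w = w' := by
  have := ((dominated_iff (Λ := Λ) hb hw hw' (Finset.empty_subset b) (Finset.empty_subset b)
    0 0).1 ⟨0, fun x hx => ⟨x, hx, by rw [h x hx.1, modelDist_self]⟩⟩).1
  rw [parabolic_empty, Subgroup.mem_bot, inv_mul_eq_one] at this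
  exact this

/-- A functional bounded on the ray of a coweight vanishes there, and the coweights other than the
one at `j` lie in the panel. -/
lemma mem_parabolic_of_posEval_le [Nontrivial Λ] (hb : IsBasis P b) {u w : V ≃ₗ[F] V}
    (hu : u ∈ sphericalWeylGroup P) (hw : w ∈ sphericalWeylGroup P) {j : ι} (hj : j ∈ b) {M : Λ}
    (h : ∀ x ∈ fundFace P b {j}, |posEval P b (act u x) - posEval P b (act w x)| ≤ M) :
    u⁻¹ * w ∈ parabolic P {j} := by
  refine mem_parabolic_of_posCorootSum_eq hb hu hw hj fun k hk hkj => ?_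
  refine sub_eq_zero.1 (eq_zero_of_forall_abs_smul_le (M := M) fun l hl => ?_)
  have := h (coweight hb k ⊗ₜ l) (tmul_mem_fundFace (fun i hi => ?_) (fun i hi => ?_) hl)
  · rwa [act_tmul, act_tmul, posEval_tmul, posEval_tmul, ← sub_smul] at this
  · by_cases hik : i = k
    · rw [hik, coroot'_coweight_self hb hk]; exact zero_le_one
    · rw [coroot'_coweight_of_ne hb hi hk hik]
  · rw [Finset.mem_singleton.1 hi]
    exact coroot'_coweight_of_ne hb hj hk hkj.symm

/-- No half-apartment contains chambers in all directions. -/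
lemma exists_notMem_halfApartment [Nontrivial Λ] (hb : IsBasis P b) (i : ι) (l : Λ)
    (t : (V ≃ₗ[F] V) → V ⊗[F] Λ) :
    ∃ w ∈ sphericalWeylGroup P, ∃ x ∈ fundChamber P b, ¬ l ≤ evalCoroot P Λ i (act w x + t w) := by
  by_contra! h
  set v := facePoint hb ∅
  have hv : ∀ j ∈ b, 0 ≤ P.coroot' j v := fun j hj => coroot'_facePoint_nonneg hb ∅ hj
  have key : ∀ w ∈ sphericalWeylGroup P, 0 ≤ P.coroot' i (w v) := by
    intro w hw
    refine nonneg_of_forall_le_smul (M := l - evalCoroot P Λ i (t w)) fun m hm => ?_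
    have := h w hw (v ⊗ₜ m) (tmul_mem_fundFace (J := ∅) hv (by simp) hm).1
    rwa [map_add, act_tmul, evalCoroot_tmul, ← sub_le_iff_le_add] at this
  -- The coroot takes opposite values at `v` and `s_i v`. If both are non-negative, `v` lies on a
  -- wall, although its stabilizer is trivial.
  have h1 := key 1 (one_mem _)
  have h2 := key _ (reflection_mem P i)
  rw [RootPairing.reflection_apply, map_sub, map_smul, RootPairing.root_coroot'_eq_pairing,
    RootPairing.pairing_same, smul_eq_mul] at h2
  have h0 : P.coroot' i v = 0 := le_antisymm (by linarith) h1
  have h3 := (mem_parabolic_iff hb (Finset.empty_subset b) (reflection_mem P i)).2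
    (reflection_apply_eq_self h0)
  rw [parabolic_empty, Subgroup.mem_bot] at h3
  have h4 := P.reflection_apply_self i
  rw [h3] at h4
  have h5 : (2 : F) • P.root i = 0 := by
    rw [two_smul]
    nth_rewrite 2 [show P.root i = -P.root i from h4]
    exact add_neg_cancel _
  exact (smul_ne_zero two_ne_zero (P.ne_zero i)) h5

end Model

/-! ### Cones in the building and the distance function -/

section Cones

variable {F : Subfield ℝ} {ι V V' Λ X : Type*} [Fintype ι]
  [AddCommGroup V] [Module F V] [AddCommGroup V'] [Module F V']
  [AddCommGroup Λ] [LinearOrder Λ] [IsOrderedAddMonoid Λ] [Module F Λ] [PosSMulMono F Λ]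
  {P : RootPairing ι F V V'} {b : Finset ι} {T : AddSubgroup (V ⊗[F] Λ)}
  {𝒜 : Set (V ⊗[F] Λ → X)}

/-- The image under `f` of the face of type `J` of the Weyl chamber with base point `t` and
direction `w`. -/
def cone (P : RootPairing ι F V V') (b : Finset ι) (f : V ⊗[F] Λ → X) (w : V ≃ₗ[F] V)
    (t : V ⊗[F] Λ) (J : Finset ι) : Set X :=
  (fun x => f (act w x + t)) '' fundFace P b J

lemma image_image_fundFace (f : V ⊗[F] Λ → X) {g : V ⊗[F] Λ → V ⊗[F] Λ} {w : V ≃ₗ[F] V}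
    {t : V ⊗[F] Λ} (hg : ∀ x, g x = act w x + t) (J : Finset ι) :
    f '' (g '' fundFace P b J) = cone P b f w t J := by
  rw [Set.image_image, cone]
  simp only [hg]

lemma affine_mem_fullAffineWeylGroup {w : V ≃ₗ[F] V} (hw : w ∈ sphericalWeylGroup P)
    (t : V ⊗[F] Λ) : (fun x => act w x + t) ∈ fullAffineWeylGroup P Λ :=
  ⟨w, hw, t, trivial, fun _ => rfl⟩

lemma isWeylSimplex_iff {S : Set X} : IsWeylSimplex P b 𝒜 S ↔
    ∃ f ∈ 𝒜, ∃ w ∈ sphericalWeylGroup P, ∃ t, ∃ J ⊆ b, S = cone P b f w t J := by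
  constructor
  · rintro ⟨f, hf, g, ⟨w, hw, t, -, hg⟩, J, hJ, rfl⟩
    exact ⟨f, hf, w, hw, t, J, hJ, image_image_fundFace f hg J⟩
  · rintro ⟨f, hf, w, hw, t, J, hJ, rfl⟩
    exact ⟨f, hf, _, affine_mem_fullAffineWeylGroup hw t, J, hJ,
      (image_image_fundFace f (fun _ => rfl) J).symm⟩

lemma isWeylChamber_iff {S : Set X} : IsWeylChamber P b 𝒜 S ↔
    ∃ f ∈ 𝒜, ∃ w ∈ sphericalWeylGroup P, ∃ t, S = cone P b f w t ∅ := by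
  constructor
  · rintro ⟨f, hf, g, ⟨w, hw, t, -, hg⟩, rfl⟩
    exact ⟨f, hf, w, hw, t, by rw [← fundFace_empty, image_image_fundFace f hg]⟩
  · rintro ⟨f, hf, w, hw, t, rfl⟩
    exact ⟨f, hf, _, affine_mem_fullAffineWeylGroup hw t, by
      rw [← fundFace_empty, image_image_fundFace f fun _ => rfl]⟩

lemma isFace_iff {S₁ S₂ : Set X} : IsFace P b 𝒜 S₁ S₂ ↔
    ∃ f ∈ 𝒜, ∃ w ∈ sphericalWeylGroup P, ∃ t, ∃ J₁ ⊆ b, ∃ J₂ ⊆ J₁,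
      S₁ = cone P b f w t J₁ ∧ S₂ = cone P b f w t J₂ := by
  constructor
  · rintro ⟨f, hf, g, ⟨w, hw, t, -, hg⟩, J₁, h1, J₂, h2, rfl, rfl⟩
    exact ⟨f, hf, w, hw, t, J₁, h1, J₂, h2, image_image_fundFace f hg _,
      image_image_fundFace f hg _⟩
  · rintro ⟨f, hf, w, hw, t, J₁, h1, J₂, h2, rfl, rfl⟩
    exact ⟨f, hf, _, affine_mem_fullAffineWeylGroup hw t, J₁, h1, J₂, h2,
      (image_image_fundFace f (fun _ => rfl) _).symm,
      (image_image_fundFace f (fun _ => rfl) _).symm⟩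

lemma cone_subset_range (f : V ⊗[F] Λ → X) (w : V ≃ₗ[F] V) (t : V ⊗[F] Λ) (J : Finset ι) :
    cone P b f w t J ⊆ Set.range f := by
  rintro _ ⟨x, -, rfl⟩
  exact ⟨_, rfl⟩

lemma apply_mem_cone (f : V ⊗[F] Λ → X) (w : V ≃ₗ[F] V) (t : V ⊗[F] Λ) (J : Finset ι) :
    f t ∈ cone P b f w t J :=
  ⟨0, zero_mem_fundFace P b J, by simp only [map_zero, zero_add]⟩

lemma cone_congr {f g : V ⊗[F] Λ → X} {w u : V ≃ₗ[F] V} {t s : V ⊗[F] Λ}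
    (h : ∀ x ∈ (fundChamber P b : Set (V ⊗[F] Λ)), f (act w x + t) = g (act u x + s))
    (J : Finset ι) : cone P b f w t J = cone P b g u s J :=
  Set.image_congr fun x hx => h x hx.1

/-- `S₁` lies in a bounded neighbourhood of `S₂`. -/
def Dominated (P : RootPairing ι F V V') (b : Finset ι) (𝒜 : Set (V ⊗[F] Λ → X))
    (S₁ S₂ : Set X) : Prop :=
  ∃ N : Λ, ∀ x ∈ S₁, ∃ y ∈ S₂, dist P b 𝒜 x y ≤ N

lemma parallel_iff {S₁ S₂ : Set X} :
    Parallel P b 𝒜 S₁ S₂ ↔ Dominated P b 𝒜 S₁ S₂ ∧ Dominated P b 𝒜 S₂ S₁ := by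
  constructor
  · rintro ⟨N, h1, h2⟩
    exact ⟨⟨N, h1⟩, ⟨N, h2⟩⟩
  · rintro ⟨⟨N, h1⟩, ⟨M, h2⟩⟩
    refine ⟨max N M, fun x hx => ?_, fun x hx => ?_⟩
    · obtain ⟨y, hy, h⟩ := h1 x hx
      exact ⟨y, hy, h.trans (le_max_left _ _)⟩
    · obtain ⟨y, hy, h⟩ := h2 x hx
      exact ⟨y, hy, h.trans (le_max_right _ _)⟩

lemma Parallel.symm {S₁ S₂ : Set X} (h : Parallel P b 𝒜 S₁ S₂) : Parallel P b 𝒜 S₂ S₁ :=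
  parallel_iff.2 (parallel_iff.1 h).symm

namespace IsAffineBuilding

lemma exists_transition (hX : IsAffineBuilding P b T 𝒜) {f g : V ⊗[F] Λ → X} (hf : f ∈ 𝒜)
    (hg : g ∈ 𝒜) (h : (Set.range f ∩ Set.range g).Nonempty) :
    ∃ v ∈ sphericalWeylGroup P, ∃ s, ∀ x, f x ∈ Set.range g → f x = g (act v x + s) := by
  obtain ⟨-, m, ⟨v, hv, s, -, hm⟩, h⟩ := hX.A2 f hf g hg h
  exact ⟨v, hv, s, fun x hx => by rw [h x hx, hm]⟩

/-- Independence of the chart: by A2 charts differ on their overlap by an element of the affine Weyl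
group, which preserves `modelDist`. -/
lemma dist_eq (hX : IsAffineBuilding P b T 𝒜) (hb : IsBasis P b) {f : V ⊗[F] Λ → X} (hf : f ∈ 𝒜)
    (p q : V ⊗[F] Λ) : dist P b 𝒜 (f p) (f q) = modelDist P b p q := by
  have h : ∃ d : Λ, ∃ g ∈ 𝒜, ∃ p' q', g p' = f p ∧ g q' = f q ∧ d = modelDist P b p' q' :=
    ⟨_, f, hf, p, q, rfl, rfl, rfl⟩
  rw [dist, dif_pos h]
  obtain ⟨g, hg, p', q', hp, hq, hd⟩ := h.choose_spec
  rw [hd]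
  obtain ⟨v, hv, s, hvs⟩ := hX.exists_transition hg hf ⟨f p, ⟨p', hp⟩, ⟨p, rfl⟩⟩
  have hp' := hX.injective f hf ((hvs p' ⟨p, hp.symm⟩).symm.trans hp)
  have hq' := hX.injective f hf ((hvs q' ⟨q, hq.symm⟩).symm.trans hq)
  rw [← hp', ← hq', modelDist_add_right, modelDist_act hb hv]

lemma dist_comm (hX : IsAffineBuilding P b T 𝒜) (hb : IsBasis P b) (x y : X) :
    dist P b 𝒜 x y = dist P b 𝒜 y x := by
  obtain ⟨f, hf, ⟨p, rfl⟩, ⟨q, rfl⟩⟩ := hX.A3 x y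
  rw [hX.dist_eq hb hf, hX.dist_eq hb hf, modelDist_comm]

lemma dist_self (hX : IsAffineBuilding P b T 𝒜) (hb : IsBasis P b) (x : X) :
    dist P b 𝒜 x x = 0 := by
  obtain ⟨f, hf, ⟨p, rfl⟩, -⟩ := hX.A3 x x
  rw [hX.dist_eq hb hf, modelDist_self]

/-- Retract `y` into an apartment containing `x` and `z`; by A5 this increases neither distance on
the right. -/
lemma dist_triangle (hX : IsAffineBuilding P b T 𝒜) (hb : IsBasis P b) (x y z : X) :
    dist P b 𝒜 x z ≤ dist P b 𝒜 x y + dist P b 𝒜 y z := by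
  obtain ⟨f, hf, hx, hz⟩ := hX.A3 x z
  obtain ⟨r, hr, hid, hle, -⟩ := hX.A5 (Set.range f) ⟨f, hf, rfl⟩ x hx
  refine le_trans ?_ (add_le_add (hle x y) (hle y z))
  rw [hid x hx, hid z hz]
  obtain ⟨q, hq⟩ := hr y
  obtain ⟨p, rfl⟩ := hx
  obtain ⟨s, rfl⟩ := hz
  rw [← hq, hX.dist_eq hb hf, hX.dist_eq hb hf, hX.dist_eq hb hf]
  exact modelDist_triangle p q s

lemma dominated_refl (hX : IsAffineBuilding P b T 𝒜) (hb : IsBasis P b) (S : Set X) :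
    Dominated P b 𝒜 S S :=
  ⟨0, fun x hx => ⟨x, hx, (hX.dist_self hb x).le⟩⟩

lemma dominated_trans (hX : IsAffineBuilding P b T 𝒜) (hb : IsBasis P b) {S₁ S₂ S₃ : Set X}
    (h : Dominated P b 𝒜 S₁ S₂) (h' : Dominated P b 𝒜 S₂ S₃) : Dominated P b 𝒜 S₁ S₃ := by
  obtain ⟨N, hN⟩ := h
  obtain ⟨M, hM⟩ := h'
  refine ⟨N + M, fun x hx => ?_⟩
  obtain ⟨y, hy, h1⟩ := hN x hx
  obtain ⟨z, hz, h2⟩ := hM y hy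
  exact ⟨z, hz, (hX.dist_triangle hb x y z).trans (add_le_add h1 h2)⟩

lemma parallel_refl (hX : IsAffineBuilding P b T 𝒜) (hb : IsBasis P b) (S : Set X) :
    Parallel P b 𝒜 S S :=
  parallel_iff.2 ⟨hX.dominated_refl hb S, hX.dominated_refl hb S⟩

lemma parallel_trans (hX : IsAffineBuilding P b T 𝒜) (hb : IsBasis P b) {S₁ S₂ S₃ : Set X}
    (h : Parallel P b 𝒜 S₁ S₂) (h' : Parallel P b 𝒜 S₂ S₃) : Parallel P b 𝒜 S₁ S₃ := by
  rw [parallel_iff] at *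
  exact ⟨hX.dominated_trans hb h.1 h'.1, hX.dominated_trans hb h'.2 h.2⟩

/-! ### Comparing cones within one apartment and across apartments -/

variable [P.IsRootSystem] [Nontrivial Λ]

lemma cone_dominated_iff (hX : IsAffineBuilding P b T 𝒜) (hb : IsBasis P b) {f : V ⊗[F] Λ → X}
    (hf : f ∈ 𝒜) {w w' : V ≃ₗ[F] V} (hw : w ∈ sphericalWeylGroup P)
    (hw' : w' ∈ sphericalWeylGroup P) {J J' : Finset ι} (hJ : J ⊆ b) (hJ' : J' ⊆ b)
    (t t' : V ⊗[F] Λ) :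
    Dominated P b 𝒜 (cone P b f w t J) (cone P b f w' t' J') ↔
      w⁻¹ * w' ∈ parabolic P J ∧ J' ⊆ J := by
  rw [← dominated_iff hb hw hw' hJ hJ' t t']
  simp only [Dominated, cone, Set.forall_mem_image, Set.exists_mem_image, hX.dist_eq hb hf]

lemma cone_parallel_iff (hX : IsAffineBuilding P b T 𝒜) (hb : IsBasis P b) {f : V ⊗[F] Λ → X}
    (hf : f ∈ 𝒜) {w w' : V ≃ₗ[F] V} (hw : w ∈ sphericalWeylGroup P)
    (hw' : w' ∈ sphericalWeylGroup P) {J J' : Finset ι} (hJ : J ⊆ b) (hJ' : J' ⊆ b)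
    (t t' : V ⊗[F] Λ) :
    Parallel P b 𝒜 (cone P b f w t J) (cone P b f w' t' J') ↔
      w⁻¹ * w' ∈ parabolic P J ∧ J = J' := by
  rw [parallel_iff, hX.cone_dominated_iff hb hf hw hw' hJ hJ',
    hX.cone_dominated_iff hb hf hw' hw hJ' hJ]
  constructor
  · rintro ⟨⟨h1, h2⟩, -, h3⟩
    exact ⟨h1, h3.antisymm h2⟩
  · rintro ⟨h1, rfl⟩
    exact ⟨⟨h1, subset_rfl⟩, by simpa using inv_mem h1, subset_rfl⟩

lemma parallel_translate (hX : IsAffineBuilding P b T 𝒜) (hb : IsBasis P b)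
    {f : V ⊗[F] Λ → X} (hf : f ∈ 𝒜) {w : V ≃ₗ[F] V} (hw : w ∈ sphericalWeylGroup P)
    {J : Finset ι} (hJ : J ⊆ b) (t s : V ⊗[F] Λ) :
    Parallel P b 𝒜 (cone P b f w t J) (cone P b f w s J) :=
  (hX.cone_parallel_iff hb hf hw hw hJ hJ t s).2
    ⟨by rw [inv_mul_cancel]; exact one_mem _, rfl⟩

lemma parallel_of_eqOn (hX : IsAffineBuilding P b T 𝒜) (hb : IsBasis P b)
    {f g : V ⊗[F] Λ → X} (hf : f ∈ 𝒜) (hg : g ∈ 𝒜) {w u : V ≃ₗ[F] V}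
    (hw : w ∈ sphericalWeylGroup P) (hu : u ∈ sphericalWeylGroup P) {t s : V ⊗[F] Λ}
    (h : ∀ x ∈ (fundChamber P b : Set (V ⊗[F] Λ)), f (act w x + t) = g (act u x + s))
    {J : Finset ι} (hJ : J ⊆ b) :
    Parallel P b 𝒜 (cone P b f w 0 J) (cone P b g u 0 J) := by
  have := hX.parallel_translate hb hf hw hJ 0 t
  rw [cone_congr h J] at this
  exact hX.parallel_trans hb this (hX.parallel_translate hb hg hu hJ s 0)

lemma exists_chart_of_subset (hX : IsAffineBuilding P b T 𝒜) {f g : V ⊗[F] Λ → X} (hf : f ∈ 𝒜)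
    (hg : g ∈ 𝒜) {w : V ≃ₗ[F] V} (hw : w ∈ sphericalWeylGroup P) {t : V ⊗[F] Λ} {J : Finset ι}
    (h : cone P b f w t J ⊆ Set.range g) :
    ∃ u ∈ sphericalWeylGroup P, ∃ s, ∀ x ∈ fundFace P b J,
      f (act w x + t) = g (act u x + s) := by
  obtain ⟨v, hv, s, hvs⟩ := hX.exists_transition hf hg
    ⟨f t, ⟨t, rfl⟩, h (apply_mem_cone f w t J)⟩
  refine ⟨v * w, mul_mem hv hw, act v t + s, fun x hx => ?_⟩
  rw [hvs _ (h ⟨x, hx, rfl⟩), map_add, act_mul, add_assoc]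

/-- A chamber contained in another chamber of the same apartment has the same direction, by the
domination criterion with `J = ∅`. So the subchambers supplied by A4 are translates, and both charts
can be matched on them. -/
lemma exists_subchamber (hX : IsAffineBuilding P b T 𝒜) (hb : IsBasis P b)
    {f g : V ⊗[F] Λ → X} (hf : f ∈ 𝒜) (hg : g ∈ 𝒜) {w : V ≃ₗ[F] V}
    (hw : w ∈ sphericalWeylGroup P) {t : V ⊗[F] Λ} {S : Set X} (hS : IsWeylChamber P b 𝒜 S)
    (hSf : S ⊆ cone P b f w t ∅) (hSg : S ⊆ Set.range g) :
    ∃ t', ∃ u ∈ sphericalWeylGroup P, ∃ s,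
      ∀ x ∈ (fundChamber P b : Set (V ⊗[F] Λ)), f (act w x + t') = g (act u x + s) := by
  obtain ⟨f₁, hf₁, w₁, hw₁, t₁, rfl⟩ := isWeylChamber_iff.1 hS
  obtain ⟨u, hu, s, h1⟩ := hX.exists_chart_of_subset hf₁ hf hw₁
    (hSf.trans (cone_subset_range f w t ∅))
  obtain ⟨u', hu', s', h2⟩ := hX.exists_chart_of_subset hf₁ hg hw₁ hSg
  have hd : Dominated P b 𝒜 (cone P b f u s ∅) (cone P b f w t ∅) := by
    refine ⟨0, fun x hx => ⟨x, hSf ?_, (hX.dist_self hb x).le⟩⟩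
    rwa [cone, Set.image_congr h1]
  have huw := ((hX.cone_dominated_iff hb hf hu hw (Finset.empty_subset b)
    (Finset.empty_subset b) s t).1 hd).1
  rw [parabolic_empty, Subgroup.mem_bot, inv_mul_eq_one] at huw
  subst huw
  rw [fundFace_empty] at h1 h2
  exact ⟨s, u', hu', s', fun x hx => (h1 x hx).symm.trans (h2 x hx)⟩

/-- Any two Weyl chambers contain subchambers in a common apartment. -/
lemma exists_common_chart (hX : IsAffineBuilding P b T 𝒜) (hb : IsBasis P b)
    {f f' : V ⊗[F] Λ → X} (hf : f ∈ 𝒜) (hf' : f' ∈ 𝒜) {w w' : V ≃ₗ[F] V}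
    (hw : w ∈ sphericalWeylGroup P) (hw' : w' ∈ sphericalWeylGroup P) :
    ∃ g ∈ 𝒜, ∃ u ∈ sphericalWeylGroup P, ∃ u' ∈ sphericalWeylGroup P, ∃ t t' s s',
      (∀ x ∈ (fundChamber P b : Set (V ⊗[F] Λ)), f (act w x + t) = g (act u x + s)) ∧
      ∀ x ∈ (fundChamber P b : Set (V ⊗[F] Λ)), f' (act w' x + t') = g (act u' x + s') := by
  obtain ⟨S, S', hS, hS', h1, h2, g, hg, h3⟩ := hX.A4 (cone P b f w 0 ∅) (cone P b f' w' 0 ∅)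
    (isWeylChamber_iff.2 ⟨f, hf, w, hw, 0, rfl⟩) (isWeylChamber_iff.2 ⟨f', hf', w', hw', 0, rfl⟩)
  obtain ⟨h3, h4⟩ := Set.union_subset_iff.1 h3
  obtain ⟨t, u, hu, s, h5⟩ := hX.exists_subchamber hb hf hg hw hS h1 h3
  obtain ⟨t', u', hu', s', h6⟩ := hX.exists_subchamber hb hf' hg hw' hS' h2 h4
  exact ⟨g, hg, u, hu, u', hu', t, t', s, s', h5, h6⟩

/-- The form in which A4 is used at infinity: two chambers are moved into one apartment
simultaneously with all their faces. -/
lemma exists_common_directions (hX : IsAffineBuilding P b T 𝒜) (hb : IsBasis P b)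
    {f f' : V ⊗[F] Λ → X} (hf : f ∈ 𝒜) (hf' : f' ∈ 𝒜) {w w' : V ≃ₗ[F] V}
    (hw : w ∈ sphericalWeylGroup P) (hw' : w' ∈ sphericalWeylGroup P) :
    ∃ g ∈ 𝒜, ∃ u ∈ sphericalWeylGroup P, ∃ u' ∈ sphericalWeylGroup P,
      (∀ J ⊆ b, Parallel P b 𝒜 (cone P b f w 0 J) (cone P b g u 0 J)) ∧
      ∀ J ⊆ b, Parallel P b 𝒜 (cone P b f' w' 0 J) (cone P b g u' 0 J) := by
  obtain ⟨g, hg, u, hu, u', hu', t, t', s, s', h1, h2⟩ :=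
    hX.exists_common_chart hb hf hf' hw hw'
  exact ⟨g, hg, u, hu, u', hu', fun J hJ => hX.parallel_of_eqOn hb hf hg hw hu h1 hJ,
    fun J hJ => hX.parallel_of_eqOn hb hf' hg hw' hu' h2 hJ⟩

/-- If a simplicial cone is coarsely contained in another one, then its faces are parallel to
faces of the other one. -/
lemma parallel_faces_of_dominated (hX : IsAffineBuilding P b T 𝒜) (hb : IsBasis P b)
    {f f' : V ⊗[F] Λ → X} (hf : f ∈ 𝒜) (hf' : f' ∈ 𝒜) {w w' : V ≃ₗ[F] V}
    (hw : w ∈ sphericalWeylGroup P) (hw' : w' ∈ sphericalWeylGroup P) {J J' : Finset ι}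
    (hJ : J ⊆ b) (hJ' : J' ⊆ b)
    (h : Dominated P b 𝒜 (cone P b f w 0 J) (cone P b f' w' 0 J')) :
    J' ⊆ J ∧ ∀ K ⊆ b, J ⊆ K → Parallel P b 𝒜 (cone P b f w 0 K) (cone P b f' w' 0 K) := by
  obtain ⟨g, hg, u, hu, u', hu', h1, h2⟩ := hX.exists_common_directions hb hf hf' hw hw'
  have h3 := hX.dominated_trans hb (hX.dominated_trans hb (parallel_iff.1 (h1 J hJ)).2 h)
    (parallel_iff.1 (h2 J' hJ')).1
  rw [hX.cone_dominated_iff hb hg hu hu' hJ hJ'] at h3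
  refine ⟨h3.2, fun K hK hJK => hX.parallel_trans hb (h1 K hK)
    (hX.parallel_trans hb ?_ (h2 K hK).symm)⟩
  exact (hX.cone_parallel_iff hb hg hu hu' hK hK 0 0).2 ⟨parabolic_mono P hJK h3.1, rfl⟩

/-- In a common chart both chambers have the same direction and differ only in base points; moving
far enough into the chamber reaches a translate contained in both. -/
lemma exists_common_subchamber (hX : IsAffineBuilding P b T 𝒜) (hb : IsBasis P b)
    {f f' : V ⊗[F] Λ → X} (hf : f ∈ 𝒜) (hf' : f' ∈ 𝒜) {w w' : V ≃ₗ[F] V}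
    (hw : w ∈ sphericalWeylGroup P) (hw' : w' ∈ sphericalWeylGroup P)
    (h : Parallel P b 𝒜 (cone P b f w 0 ∅) (cone P b f' w' 0 ∅)) :
    ∃ t t', ∀ x ∈ (fundChamber P b : Set (V ⊗[F] Λ)), f (act w x + t) = f' (act w' x + t') := by
  obtain ⟨g, hg, u, hu, u', hu', t, t', s, s', h1, h2⟩ :=
    hX.exists_common_chart hb hf hf' hw hw'
  have hE := Finset.empty_subset b
  have h3 := hX.parallel_trans hb (hX.parallel_of_eqOn hb hf hg hw hu h1 hE).symm
    (hX.parallel_trans hb h (hX.parallel_of_eqOn hb hf' hg hw' hu' h2 hE))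
  have huu := ((hX.cone_parallel_iff hb hg hu hu' hE hE 0 0).1 h3).1
  rw [parabolic_empty, Subgroup.mem_bot, inv_mul_eq_one] at huu
  subst huu
  obtain ⟨c, hc, hc', -⟩ := exists_add_mem_fundChamber hb (act u⁻¹ (s' - s)) 0
  refine ⟨act w (c + act u⁻¹ (s' - s)) + t, act w' c + t', fun x hx => ?_⟩
  rw [← add_assoc, ← add_assoc, ← map_add, ← map_add, h1 _ (add_mem_fundChamber hx hc'),
    h2 _ (add_mem_fundChamber hx hc), map_add, map_add, map_add, act_act_inv]
  congr 1
  abel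

/-- The relative position of two chambers at infinity does not depend on the apartment. -/
lemma inv_mul_eq_of_parallel (hX : IsAffineBuilding P b T 𝒜) (hb : IsBasis P b)
    {f f' : V ⊗[F] Λ → X} (hf : f ∈ 𝒜) (hf' : f' ∈ 𝒜) {w w' w₁ w₁' : V ≃ₗ[F] V}
    (hw : w ∈ sphericalWeylGroup P) (hw' : w' ∈ sphericalWeylGroup P)
    (hw₁ : w₁ ∈ sphericalWeylGroup P) (hw₁' : w₁' ∈ sphericalWeylGroup P)
    (h : Parallel P b 𝒜 (cone P b f w 0 ∅) (cone P b f' w' 0 ∅))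
    (h₁ : Parallel P b 𝒜 (cone P b f w₁ 0 ∅) (cone P b f' w₁' 0 ∅)) :
    w⁻¹ * w₁ = w'⁻¹ * w₁' := by
  obtain ⟨t, t', h2⟩ := hX.exists_common_subchamber hb hf hf' hw hw' h
  obtain ⟨s, s', h3⟩ := hX.exists_common_subchamber hb hf hf' hw₁ hw₁' h₁
  have h0 : (0 : V ⊗[F] Λ) ∈ fundChamber P b := (zero_mem_fundFace P b ∅).1
  obtain ⟨v, hv, a, hva⟩ := hX.exists_transition hf hf' ⟨_, ⟨_, rfl⟩, ⟨_, (h2 0 h0).symm⟩⟩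
  -- The linear part `v` of the transition map carries every shared direction in `f` to the
  -- corresponding one in `f'`, so it cancels in `w⁻¹ w₁`.
  have key : ∀ {u u' : V ≃ₗ[F] V}, u ∈ sphericalWeylGroup P → u' ∈ sphericalWeylGroup P →
      ∀ {c c' : V ⊗[F] Λ}, (∀ x ∈ (fundChamber P b : Set (V ⊗[F] Λ)),
        f (act u x + c) = f' (act u' x + c')) → v * u = u' := by
    intro u u' hu hu' c c' hc
    have e : ∀ x ∈ (fundChamber P b : Set (V ⊗[F] Λ)),
        act (v * u) x + (act v c + a) = act u' x + c' := by
      intro x hx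
      have h4 := hva (act u x + c) ⟨_, (hc x hx).symm⟩
      rw [hc x hx] at h4
      rw [hX.injective f' hf' h4, map_add, act_mul, add_assoc]
    have e0 := e 0 h0
    rw [map_zero, map_zero, zero_add, zero_add] at e0
    refine eq_of_act_eq (Λ := Λ) hb (mul_mem hv hu) hu' fun x hx => ?_
    have := e x hx
    rwa [e0, add_left_inj] at this
  rw [← key hw hw' h2, ← key hw₁ hw₁' h3, mul_inv_rev, mul_assoc, inv_mul_cancel_left]

/-- The relative position of a chamber and a panel at infinity does not depend on the apartment. -/
lemma mem_parabolic_of_parallel_panel (hX : IsAffineBuilding P b T 𝒜) (hb : IsBasis P b)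
    {f f' : V ⊗[F] Λ → X} (hf : f ∈ 𝒜) (hf' : f' ∈ 𝒜) {w w' w₁ w₁' : V ≃ₗ[F] V}
    (hw : w ∈ sphericalWeylGroup P) (hw' : w' ∈ sphericalWeylGroup P)
    (hw₁ : w₁ ∈ sphericalWeylGroup P) (hw₁' : w₁' ∈ sphericalWeylGroup P) {j : ι} (hj : j ∈ b)
    (h : Parallel P b 𝒜 (cone P b f w 0 ∅) (cone P b f' w' 0 ∅))
    (h₁ : Parallel P b 𝒜 (cone P b f w₁ 0 {j}) (cone P b f' w₁' 0 {j})) :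
    (w⁻¹ * w₁)⁻¹ * (w'⁻¹ * w₁') ∈ parabolic P {j} := by
  obtain ⟨t, t', h2⟩ := hX.exists_common_subchamber hb hf hf' hw hw' h
  obtain ⟨g, hg, u, hu, u', hu', t₁, t₁', s, s', h3, h4⟩ :=
    hX.exists_common_chart hb hf hf' hw₁ hw₁'
  have hjb : {j} ⊆ b := Finset.singleton_subset_iff.2 hj
  have h5 := hX.parallel_trans hb (hX.parallel_of_eqOn hb hf hg hw₁ hu h3 hjb).symm
    (hX.parallel_trans hb h₁ (hX.parallel_of_eqOn hb hf' hg hw₁' hu' h4 hjb))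
  have huu := ((hX.cone_parallel_iff hb hg hu hu' hjb hjb 0 0).1 h5).1
  -- In the chart `g` the two panels are translates of each other, so corresponding points have the
  -- constant distance `N`. The vectors `c` and `c'` account for the base points.
  set N := modelDist P b s s'
  set c := act w⁻¹ (t₁ - t)
  set c' := act w'⁻¹ (t₁' - t')
  refine mem_parabolic_of_posEval_le hb (mul_mem (inv_mem hw) hw₁) (mul_mem (inv_mem hw') hw₁')
    hj (M := N + |posEval P b (c' - c)|) fun x hx => ?_
  set z := act (w⁻¹ * w₁) x + c
  set z' := act (w'⁻¹ * w₁') x + c'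
  -- A point `y` of the shared subchamber so deep that it is dominant relative to both panel points,
  -- which makes both distances to it linear.
  obtain ⟨y, hy, hyz, hyz'⟩ := exists_add_mem_fundChamber hb (-z) (-z')
  rw [← sub_eq_add_neg] at hyz hyz'
  have d : dist P b 𝒜 (f (act w₁ x + t₁)) (f' (act w₁' x + t₁')) = N := by
    have e : act u' x = act u x := by
      conv_rhs => rw [← act_eq_self_of_mem_fundFace hb hjb huu hx, ← act_mul,
        mul_inv_cancel_left]
    rw [h3 x hx.1, h4 x hx.1, e, hX.dist_eq hb hg, modelDist_add_left]
  have d1 : dist P b 𝒜 (f (act w₁ x + t₁)) (f (act w y + t)) = posEval P b (y - z) := by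
    rw [hX.dist_eq hb hf, ← modelDist_eq_posEval hyz, ← modelDist_act hb hw z y,
      ← modelDist_add_right (act w z) _ t]
    congr 1
    rw [map_add, act_mul, act_act_inv, act_act_inv]
    abel
  have d2 : dist P b 𝒜 (f' (act w₁' x + t₁')) (f (act w y + t)) = posEval P b (y - z') := by
    rw [h2 y hy, hX.dist_eq hb hf', ← modelDist_eq_posEval hyz', ← modelDist_act hb hw' z' y,
      ← modelDist_add_right (act w' z') _ t']
    congr 1
    rw [map_add, act_mul, act_act_inv, act_act_inv]
    abel
  have tri1 := hX.dist_triangle hb (f (act w₁ x + t₁)) (f' (act w₁' x + t₁')) (f (act w y + t))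
  have tri2 := hX.dist_triangle hb (f' (act w₁' x + t₁')) (f (act w₁ x + t₁)) (f (act w y + t))
  rw [hX.dist_comm hb (f' (act w₁' x + t₁')) (f (act w₁ x + t₁))] at tri2
  rw [d, d1, d2, ← sub_le_iff_le_add, ← map_sub, sub_sub_sub_cancel_left] at tri1 tri2
  -- The unknown `y` cancels, so the bound is uniform in the panel point `x`.
  have hzz : |posEval P b (z' - z)| ≤ N := by
    rw [abs_le', ← map_neg, neg_sub]
    exact ⟨tri1, tri2⟩
  rw [← map_sub]
  have e : act (w⁻¹ * w₁) x - act (w'⁻¹ * w₁') x = -(z' - z) + (c' - c) := by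
    simp only [z, z']; abel
  rw [e, map_add, map_neg]
  refine (abs_add_le _ _).trans (add_le_add ?_ le_rfl)
  rwa [abs_neg]

/-- The relative position of a chamber and a simplex at infinity does not depend on the
apartment. -/
lemma mem_parabolic_of_parallel (hX : IsAffineBuilding P b T 𝒜) (hb : IsBasis P b)
    {f f' : V ⊗[F] Λ → X} (hf : f ∈ 𝒜) (hf' : f' ∈ 𝒜) {w w' w₁ w₁' : V ≃ₗ[F] V}
    (hw : w ∈ sphericalWeylGroup P) (hw' : w' ∈ sphericalWeylGroup P)
    (hw₁ : w₁ ∈ sphericalWeylGroup P) (hw₁' : w₁' ∈ sphericalWeylGroup P) {J : Finset ι}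
    (hJ : J ⊆ b) (h : Parallel P b 𝒜 (cone P b f w 0 ∅) (cone P b f' w' 0 ∅))
    (h₁ : Parallel P b 𝒜 (cone P b f w₁ 0 J) (cone P b f' w₁' 0 J)) :
    (w⁻¹ * w₁)⁻¹ * (w'⁻¹ * w₁') ∈ parabolic P J := by
  obtain ⟨g, hg, u, hu, u', hu', h2, h3⟩ := hX.exists_common_directions hb hf hf' hw₁ hw₁'
  have hE := Finset.empty_subset b
  have huu := ((hX.cone_parallel_iff hb hg hu hu' hJ hJ 0 0).1
    (hX.parallel_trans hb (h2 J hJ).symm (hX.parallel_trans hb h₁ (h3 J hJ)))).1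
  -- In the apartment of `g`, a gallery leads from the chamber `u` to `u'` through chambers having
  -- the given face of type `J`. Induct along it, over all apartments that contain the fixed chamber
  -- and the current one. Panels are needed because equality of the functionals on a smaller face
  -- does not determine the directions up to `W_J`.
  have key : ∀ v ∈ parabolic P J, ∀ f' ∈ 𝒜, ∀ w' ∈ sphericalWeylGroup P,
      ∀ w₁' ∈ sphericalWeylGroup P, Parallel P b 𝒜 (cone P b f w 0 ∅) (cone P b f' w' 0 ∅) →
      Parallel P b 𝒜 (cone P b f' w₁' 0 ∅) (cone P b g (u * v) 0 ∅) →
        (w⁻¹ * w₁)⁻¹ * (w'⁻¹ * w₁') ∈ parabolic P J := by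
    intro v hv
    have step : ∀ v ∈ parabolic P J, ∀ j ∈ J, (∀ f' ∈ 𝒜, ∀ w' ∈ sphericalWeylGroup P,
        ∀ w₁' ∈ sphericalWeylGroup P, Parallel P b 𝒜 (cone P b f w 0 ∅) (cone P b f' w' 0 ∅) →
        Parallel P b 𝒜 (cone P b f' w₁' 0 ∅) (cone P b g (u * v) 0 ∅) →
          (w⁻¹ * w₁)⁻¹ * (w'⁻¹ * w₁') ∈ parabolic P J) → ∀ f' ∈ 𝒜, ∀ w' ∈ sphericalWeylGroup P,
        ∀ w₁' ∈ sphericalWeylGroup P, Parallel P b 𝒜 (cone P b f w 0 ∅) (cone P b f' w' 0 ∅) →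
        Parallel P b 𝒜 (cone P b f' w₁' 0 ∅) (cone P b g (u * (v * P.reflection j)) 0 ∅) →
          (w⁻¹ * w₁)⁻¹ * (w'⁻¹ * w₁') ∈ parabolic P J := by
      intro v hv j hj ih f' hf' w' hw' w₁' hw₁' h4 h5
      have hjb : {j} ⊆ b := Finset.singleton_subset_iff.2 (hJ hj)
      have huv := mul_mem hu (parabolic_le P J hv)
      have huvj := mul_mem hu (mul_mem (parabolic_le P J hv) (reflection_mem P j))
      -- The apartment of `k` contains the previous chamber of the gallery, and its panel of type
      -- `j` also lies in `f'` at infinity, so the panel case compares `k` with `f'`.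
      obtain ⟨k, hk, w₂, hw₂, w₃, hw₃, h6, h7⟩ := hX.exists_common_directions hb hf hg hw huv
      have h8 := ih k hk w₂ hw₂ w₃ hw₃ (h6 ∅ hE) (h7 ∅ hE).symm
      have h9 : Parallel P b 𝒜 (cone P b g (u * v) 0 {j})
          (cone P b g (u * (v * P.reflection j)) 0 {j}) := by
        refine (hX.cone_parallel_iff hb hg huv huvj hjb hjb 0 0).2 ⟨?_, rfl⟩
        rw [← mul_assoc u, inv_mul_cancel_left]
        exact reflection_mem_parabolic P (Finset.mem_singleton_self j)
      have h10 := (hX.parallel_faces_of_dominated hb hf' hg hw₁' huvj hE hE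
        (parallel_iff.1 h5).1).2 {j} hjb (Finset.empty_subset _)
      have h11 := hX.mem_parabolic_of_parallel_panel hb hk hf' hw₂ hw' hw₃ hw₁' (hJ hj)
        (hX.parallel_trans hb (h6 ∅ hE).symm h4) (hX.parallel_trans hb (h7 {j} hjb).symm
          (hX.parallel_trans hb h9 h10.symm))
      have h12 := mul_mem h8 (parabolic_mono P (Finset.singleton_subset_iff.2 hj) h11)
      rwa [mul_assoc, mul_inv_cancel_left] at h12
    induction hv using Subgroup.closure_induction_right with
    | one =>
      intro f' hf' w' hw' w₁' hw₁' h4 h5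
      rw [mul_one] at h5
      rw [hX.inv_mul_eq_of_parallel hb hf hf' hw hw' hw₁ hw₁' h4
        (hX.parallel_trans hb (h2 ∅ hE) h5.symm), inv_mul_cancel]
      exact one_mem _
    | mul_right v hv y hy ih =>
      obtain ⟨j, hj, rfl⟩ := hy
      exact step v hv j hj ih
    | mul_inv_cancel v hv y hy ih =>
      obtain ⟨j, hj, rfl⟩ := hy
      rw [RootPairing.reflection_inv]
      exact step v hv j hj ih
  exact key _ huu f' hf' w' hw' w₁' hw₁' h (by rw [mul_inv_cancel_left]; exact h3 ∅ hE)

end IsAffineBuilding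

end Cones

/-! ### The complex at infinity -/

section Infinity

variable {F : Subfield ℝ} {ι V V' Λ X : Type*} [Fintype ι]
  [AddCommGroup V] [Module F V] [AddCommGroup V'] [Module F V']
  [AddCommGroup Λ] [LinearOrder Λ] [IsOrderedAddMonoid Λ] [Module F Λ] [PosSMulMono F Λ]
  {P : RootPairing ι F V V'} {b : Finset ι} {T : AddSubgroup (V ⊗[F] Λ)}
  {𝒜 : Set (V ⊗[F] Λ → X)}

/-- The condition is the one that governs coarse containment of cones; this coincidence identifies
`∂A` with the Coxeter complex. -/
lemma coset_subset_iff [P.IsRootSystem] (hb : IsBasis P b) {w w' : V ≃ₗ[F] V} {J J' : Finset ι}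
    (hJ : J ⊆ b) (hJ' : J' ⊆ b) :
    (fun u => w' * u) '' (Subgroup.closure (P.reflection '' (J' : Set ι)) : Set (V ≃ₗ[F] V)) ⊆
      (fun u => w * u) '' (Subgroup.closure (P.reflection '' (J : Set ι)) : Set (V ≃ₗ[F] V)) ↔
      w⁻¹ * w' ∈ parabolic P J ∧ J' ⊆ J := by
  change (fun u => w' * u) '' (parabolic P J' : Set (V ≃ₗ[F] V)) ⊆
    (fun u => w * u) '' (parabolic P J : Set (V ≃ₗ[F] V)) ↔ _
  constructor
  · intro h
    have key : ∀ v ∈ parabolic P J', w⁻¹ * w' * v ∈ parabolic P J := by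
      intro v hv
      obtain ⟨u, hu, hwu⟩ := h ⟨v, hv, rfl⟩
      have hwu : w * u = w' * v := hwu
      rwa [mul_assoc, ← hwu, inv_mul_cancel_left]
    have h1 := key 1 (one_mem _)
    rw [mul_one] at h1
    refine ⟨h1, (parabolic_le_iff hb hJ' hJ).1 fun v hv => ?_⟩
    have := mul_mem (inv_mem h1) (key v hv)
    rwa [inv_mul_cancel_left] at this
  · rintro ⟨h1, h2⟩ _ ⟨v, hv, rfl⟩
    refine ⟨w⁻¹ * w' * v, mul_mem h1 (parabolic_mono P h2 hv), ?_⟩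
    change w * (w⁻¹ * w' * v) = w' * v
    rw [mul_assoc, mul_inv_cancel_left]

/-- The coset `w W_J`, as a simplex of the Coxeter complex. -/
def cosetSimplex {w : V ≃ₗ[F] V} (hw : w ∈ sphericalWeylGroup P) {J : Finset ι} (hJ : J ⊆ b) :
    CoxeterSimplex P b :=
  ⟨_, w, hw, J, hJ, rfl⟩

lemma coxeterFace_iff [P.IsRootSystem] (hb : IsBasis P b) {w w' : V ≃ₗ[F] V}
    (hw : w ∈ sphericalWeylGroup P) (hw' : w' ∈ sphericalWeylGroup P) {J J' : Finset ι}
    (hJ : J ⊆ b) (hJ' : J' ⊆ b) :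
    CoxeterFace P b (cosetSimplex hw hJ) (cosetSimplex hw' hJ') ↔
      w⁻¹ * w' ∈ parabolic P J ∧ J' ⊆ J :=
  coset_subset_iff hb hJ hJ'

/-- The simplex at infinity of a cone in the direction `w` of type `J`. -/
def cls {f : V ⊗[F] Λ → X} (hf : f ∈ 𝒜) {w : V ≃ₗ[F] V} (hw : w ∈ sphericalWeylGroup P)
    {J : Finset ι} (hJ : J ⊆ b) : SimplexAtInfinity P b 𝒜 :=
  ⟨parallelClass P b 𝒜 (cone P b f w 0 J), _,
    isWeylSimplex_iff.2 ⟨f, hf, w, hw, 0, J, hJ, rfl⟩, rfl⟩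

lemma mem_cls_iff {f g : V ⊗[F] Λ → X} (hf : f ∈ 𝒜) (hg : g ∈ 𝒜) {w u : V ≃ₗ[F] V}
    (hw : w ∈ sphericalWeylGroup P) (hu : u ∈ sphericalWeylGroup P) {J K : Finset ι} (hJ : J ⊆ b)
    (hK : K ⊆ b) (t : V ⊗[F] Λ) :
    cone P b g u t K ∈ (cls hf hw hJ : SimplexAtInfinity P b 𝒜).1 ↔
      Parallel P b 𝒜 (cone P b f w 0 J) (cone P b g u t K) :=
  ⟨fun h => h.2, fun h => ⟨isWeylSimplex_iff.2 ⟨g, hg, u, hu, t, K, hK, rfl⟩, h⟩⟩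

namespace IsAffineBuilding

lemma parallelClass_eq_iff (hX : IsAffineBuilding P b T 𝒜) (hb : IsBasis P b) {S S' : Set X}
    (hS : IsWeylSimplex P b 𝒜 S) : parallelClass P b 𝒜 S = parallelClass P b 𝒜 S' ↔
      Parallel P b 𝒜 S S' := by
  constructor
  · intro h
    have : S ∈ parallelClass P b 𝒜 S := ⟨hS, hX.parallel_refl hb S⟩
    rw [h] at this
    exact this.2.symm
  · intro h
    ext Q
    exact and_congr_right fun _ => ⟨fun h' => hX.parallel_trans hb h.symm h',
      fun h' => hX.parallel_trans hb h h'⟩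

lemma cls_eq_iff (hX : IsAffineBuilding P b T 𝒜) (hb : IsBasis P b) {f g : V ⊗[F] Λ → X}
    (hf : f ∈ 𝒜) (hg : g ∈ 𝒜) {w u : V ≃ₗ[F] V} (hw : w ∈ sphericalWeylGroup P)
    (hu : u ∈ sphericalWeylGroup P) {J K : Finset ι} (hJ : J ⊆ b) (hK : K ⊆ b) :
    (cls hf hw hJ : SimplexAtInfinity P b 𝒜) = cls hg hu hK ↔
      Parallel P b 𝒜 (cone P b f w 0 J) (cone P b g u 0 K) := by
  rw [← hX.parallelClass_eq_iff hb (isWeylSimplex_iff.2 ⟨f, hf, w, hw, 0, J, hJ, rfl⟩)]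
  exact Subtype.ext_iff

variable [P.IsRootSystem] [Nontrivial Λ]

lemma eq_cls_of_mem (hX : IsAffineBuilding P b T 𝒜) (hb : IsBasis P b) {f : V ⊗[F] Λ → X}
    (hf : f ∈ 𝒜) {w : V ≃ₗ[F] V} (hw : w ∈ sphericalWeylGroup P) {J : Finset ι} (hJ : J ⊆ b)
    {t : V ⊗[F] Λ} {K : SimplexAtInfinity P b 𝒜} (h : cone P b f w t J ∈ K.1) :
    K = cls hf hw hJ := by
  obtain ⟨K, S, hS, rfl⟩ := K
  exact Subtype.ext ((hX.parallelClass_eq_iff hb hS).2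
    (hX.parallel_trans hb h.2 (hX.parallel_translate hb hf hw hJ t 0)))

lemma exists_eq_cls (hX : IsAffineBuilding P b T 𝒜) (hb : IsBasis P b)
    (K : SimplexAtInfinity P b 𝒜) : ∃ (f : V ⊗[F] Λ → X) (hf : f ∈ 𝒜) (w : V ≃ₗ[F] V)
      (hw : w ∈ sphericalWeylGroup P) (J : Finset ι) (hJ : J ⊆ b), K = cls hf hw hJ := by
  obtain ⟨S, hS, hK⟩ := K.2
  obtain ⟨f, hf, w, hw, t, J, hJ, rfl⟩ := isWeylSimplex_iff.1 hS
  refine ⟨f, hf, w, hw, J, hJ, hX.eq_cls_of_mem hb hf hw hJ (t := t) ?_⟩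
  rw [hK]
  exact ⟨hS, hX.parallel_refl hb _⟩

lemma mem_cls_self (hX : IsAffineBuilding P b T 𝒜) (hb : IsBasis P b) {f : V ⊗[F] Λ → X}
    (hf : f ∈ 𝒜) {w : V ≃ₗ[F] V} (hw : w ∈ sphericalWeylGroup P) {J : Finset ι} (hJ : J ⊆ b) :
    cone P b f w 0 J ∈ (cls hf hw hJ : SimplexAtInfinity P b 𝒜).1 :=
  (mem_cls_iff hf hf hw hw hJ hJ 0).2 (hX.parallel_refl hb _)

lemma mem_boundary_iff (hX : IsAffineBuilding P b T 𝒜) (hb : IsBasis P b) {f : V ⊗[F] Λ → X}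
    (hf : f ∈ 𝒜) {K : SimplexAtInfinity P b 𝒜} : K ∈ boundary P b 𝒜 (Set.range f) ↔
      ∃ (w : V ≃ₗ[F] V) (hw : w ∈ sphericalWeylGroup P) (J : Finset ι) (hJ : J ⊆ b),
        K = cls hf hw hJ := by
  constructor
  · rintro ⟨S, hS, hSf⟩
    obtain ⟨Q, hQ, hK⟩ := K.2
    have hS' : IsWeylSimplex P b 𝒜 S := by
      rw [hK] at hS
      exact hS.1
    obtain ⟨g, hg, w, hw, t, J, hJ, rfl⟩ := isWeylSimplex_iff.1 hS'
    obtain ⟨u, hu, s, h⟩ := hX.exists_chart_of_subset hg hf hw hSf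
    refine ⟨u, hu, J, hJ, hX.eq_cls_of_mem hb hf hu hJ (t := s) ?_⟩
    rwa [cone, ← Set.image_congr h]
  · rintro ⟨w, hw, J, hJ, rfl⟩
    exact ⟨_, hX.mem_cls_self hb hf hw hJ, cone_subset_range f w 0 J⟩

/-- Coarse containment is insensitive to representatives, and a dominated cone is parallel to an
actual face of the larger one. -/
lemma faceAtInfinity_iff (hX : IsAffineBuilding P b T 𝒜) (hb : IsBasis P b)
    {f g : V ⊗[F] Λ → X} (hf : f ∈ 𝒜) (hg : g ∈ 𝒜) {w u : V ≃ₗ[F] V}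
    (hw : w ∈ sphericalWeylGroup P) (hu : u ∈ sphericalWeylGroup P) {J K : Finset ι} (hJ : J ⊆ b)
    (hK : K ⊆ b) : FaceAtInfinity P b 𝒜 (cls hf hw hJ) (cls hg hu hK) ↔
      Dominated P b 𝒜 (cone P b f w 0 J) (cone P b g u 0 K) := by
  constructor
  · rintro ⟨S₁, h1, S₂, h2, hS⟩
    obtain ⟨k, hk, v, hv, t, J₁, hJ₁, J₂, hJ₂, rfl, rfl⟩ := isFace_iff.1 hS
    refine hX.dominated_trans hb (parallel_iff.1 h1.2).1
      (hX.dominated_trans hb ?_ (parallel_iff.1 h2.2).2)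
    exact (hX.cone_dominated_iff hb hk hv hv hJ₁ (hJ₂.trans hJ₁) t t).2
      ⟨by rw [inv_mul_cancel]; exact one_mem _, hJ₂⟩
  · intro h
    obtain ⟨hKJ, h1⟩ := hX.parallel_faces_of_dominated hb hf hg hw hu hJ hK h
    exact ⟨cone P b g u 0 J, (mem_cls_iff hf hg hw hu hJ hJ 0).2 (h1 J hJ subset_rfl),
      cone P b g u 0 K, hX.mem_cls_self hb hg hu hK,
      isFace_iff.2 ⟨g, hg, u, hu, 0, J, hJ, K, hKJ, rfl, rfl⟩⟩

lemma cls_face_cls_iff (hX : IsAffineBuilding P b T 𝒜) (hb : IsBasis P b) {f : V ⊗[F] Λ → X}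
    (hf : f ∈ 𝒜) {w w' : V ≃ₗ[F] V} (hw : w ∈ sphericalWeylGroup P)
    (hw' : w' ∈ sphericalWeylGroup P) {J J' : Finset ι} (hJ : J ⊆ b) (hJ' : J' ⊆ b) :
    FaceAtInfinity P b 𝒜 (cls hf hw hJ) (cls hf hw' hJ') ↔
      w⁻¹ * w' ∈ parabolic P J ∧ J' ⊆ J := by
  rw [hX.faceAtInfinity_iff hb, hX.cone_dominated_iff hb hf hw hw' hJ hJ']

lemma cls_face_cls_self_iff (hX : IsAffineBuilding P b T 𝒜) (hb : IsBasis P b)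
    {f : V ⊗[F] Λ → X} (hf : f ∈ 𝒜) {w : V ≃ₗ[F] V} (hw : w ∈ sphericalWeylGroup P)
    {J J' : Finset ι} (hJ : J ⊆ b) (hJ' : J' ⊆ b) :
    FaceAtInfinity P b 𝒜 (cls hf hw hJ) (cls hf hw hJ') ↔ J' ⊆ J := by
  rw [hX.cls_face_cls_iff hb, inv_mul_cancel]
  exact and_iff_right (one_mem _)

/-- The faces of a simplex are visible in every apartment containing it. Transitivity, antisymmetry
and the subcomplex property follow by comparing types. -/
lemma face_cls_iff (hX : IsAffineBuilding P b T 𝒜) (hb : IsBasis P b) {f : V ⊗[F] Λ → X}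
    (hf : f ∈ 𝒜) {w : V ≃ₗ[F] V} (hw : w ∈ sphericalWeylGroup P) {J : Finset ι} (hJ : J ⊆ b)
    {K : SimplexAtInfinity P b 𝒜} : FaceAtInfinity P b 𝒜 K (cls hf hw hJ) ↔
      ∃ (J' : Finset ι) (hJ' : J' ⊆ b), J ⊆ J' ∧ K = cls hf hw hJ' := by
  constructor
  · intro h
    obtain ⟨g, hg, u, hu, J', hJ', rfl⟩ := hX.exists_eq_cls hb K
    rw [hX.faceAtInfinity_iff hb] at h
    obtain ⟨h1, h2⟩ := hX.parallel_faces_of_dominated hb hg hf hu hw hJ' hJ h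
    exact ⟨J', hJ', h1, (hX.cls_eq_iff hb hg hf hu hw hJ' hJ').2 (h2 J' hJ' subset_rfl)⟩
  · rintro ⟨J', hJ', h, rfl⟩
    exact (hX.cls_face_cls_self_iff hb hf hw hJ' hJ).2 h

lemma face_refl (hX : IsAffineBuilding P b T 𝒜) (hb : IsBasis P b)
    (K : SimplexAtInfinity P b 𝒜) : FaceAtInfinity P b 𝒜 K K := by
  obtain ⟨f, hf, w, hw, J, hJ, rfl⟩ := hX.exists_eq_cls hb K
  exact (hX.cls_face_cls_self_iff hb hf hw hJ hJ).2 subset_rfl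

lemma face_trans (hX : IsAffineBuilding P b T 𝒜) (hb : IsBasis P b)
    {K L M : SimplexAtInfinity P b 𝒜} (h : FaceAtInfinity P b 𝒜 K L)
    (h' : FaceAtInfinity P b 𝒜 L M) : FaceAtInfinity P b 𝒜 K M := by
  obtain ⟨f, hf, w, hw, J, hJ, rfl⟩ := hX.exists_eq_cls hb M
  obtain ⟨J', hJ', h1, rfl⟩ := (hX.face_cls_iff hb hf hw hJ).1 h'
  obtain ⟨J'', hJ'', h2, rfl⟩ := (hX.face_cls_iff hb hf hw hJ').1 h
  exact (hX.cls_face_cls_self_iff hb hf hw hJ'' hJ).2 (h1.trans h2)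

lemma face_antisymm (hX : IsAffineBuilding P b T 𝒜) (hb : IsBasis P b)
    {K L : SimplexAtInfinity P b 𝒜} (h : FaceAtInfinity P b 𝒜 K L)
    (h' : FaceAtInfinity P b 𝒜 L K) : K = L := by
  obtain ⟨f, hf, w, hw, J, hJ, rfl⟩ := hX.exists_eq_cls hb L
  obtain ⟨J', hJ', h1, rfl⟩ := (hX.face_cls_iff hb hf hw hJ).1 h
  obtain rfl := h1.antisymm ((hX.cls_face_cls_self_iff hb hf hw hJ hJ').1 h')
  rfl

lemma boundary_subcomplex (hX : IsAffineBuilding P b T 𝒜) (hb : IsBasis P b)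
    {f : V ⊗[F] Λ → X} (hf : f ∈ 𝒜) {K L : SimplexAtInfinity P b 𝒜}
    (hL : L ∈ boundary P b 𝒜 (Set.range f)) (h : FaceAtInfinity P b 𝒜 K L) :
    K ∈ boundary P b 𝒜 (Set.range f) := by
  obtain ⟨w, hw, J, hJ, rfl⟩ := (hX.mem_boundary_iff hb hf).1 hL
  obtain ⟨J', hJ', -, rfl⟩ := (hX.face_cls_iff hb hf hw hJ).1 h
  exact (hX.mem_boundary_iff hb hf).2 ⟨w, hw, J', hJ', rfl⟩

lemma exists_common_cls (hX : IsAffineBuilding P b T 𝒜) (hb : IsBasis P b)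
    {f f' : V ⊗[F] Λ → X} (hf : f ∈ 𝒜) (hf' : f' ∈ 𝒜) {w w' : V ≃ₗ[F] V}
    (hw : w ∈ sphericalWeylGroup P) (hw' : w' ∈ sphericalWeylGroup P) :
    ∃ (g : V ⊗[F] Λ → X) (hg : g ∈ 𝒜) (u : V ≃ₗ[F] V) (hu : u ∈ sphericalWeylGroup P)
      (u' : V ≃ₗ[F] V) (hu' : u' ∈ sphericalWeylGroup P),
      (∀ (J : Finset ι) (hJ : J ⊆ b),
        (cls hf hw hJ : SimplexAtInfinity P b 𝒜) = cls hg hu hJ) ∧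
      ∀ (J : Finset ι) (hJ : J ⊆ b),
        (cls hf' hw' hJ : SimplexAtInfinity P b 𝒜) = cls hg hu' hJ := by
  obtain ⟨g, hg, u, hu, u', hu', h1, h2⟩ := hX.exists_common_directions hb hf hf' hw hw'
  exact ⟨g, hg, u, hu, u', hu', fun J hJ => (hX.cls_eq_iff hb hf hg hw hu hJ hJ).2 (h1 J hJ),
    fun J hJ => (hX.cls_eq_iff hb hf' hg hw' hu' hJ hJ).2 (h2 J hJ)⟩

lemma exists_common_boundary (hX : IsAffineBuilding P b T 𝒜) (hb : IsBasis P b)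
    (K L : SimplexAtInfinity P b 𝒜) : ∃ f ∈ 𝒜, K ∈ boundary P b 𝒜 (Set.range f) ∧
      L ∈ boundary P b 𝒜 (Set.range f) := by
  obtain ⟨f, hf, w, hw, J, hJ, rfl⟩ := hX.exists_eq_cls hb K
  obtain ⟨f', hf', w', hw', J', hJ', rfl⟩ := hX.exists_eq_cls hb L
  obtain ⟨g, hg, u, hu, u', hu', h1, h2⟩ := hX.exists_common_cls hb hf hf' hw hw'
  exact ⟨g, hg, (hX.mem_boundary_iff hb hg).2 ⟨u, hu, J, hJ, h1 J hJ⟩,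
    (hX.mem_boundary_iff hb hg).2 ⟨u', hu', J', hJ', h2 J' hJ'⟩⟩

/-- The boundary of an apartment is isomorphic to the Coxeter complex. -/
lemma exists_coxeter_iso (hX : IsAffineBuilding P b T 𝒜) (hb : IsBasis P b)
    {f : V ⊗[F] Λ → X} (hf : f ∈ 𝒜) :
    ∃ φ : CoxeterFace P b ≃r
        Subrel (FaceAtInfinity P b 𝒜) (· ∈ boundary P b 𝒜 (Set.range f)),
      ∀ (w : V ≃ₗ[F] V) (hw : w ∈ sphericalWeylGroup P) (J : Finset ι) (hJ : J ⊆ b),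
        (φ (cosetSimplex hw hJ)).1 = cls hf hw hJ := by
  have hex : ∀ c : CoxeterSimplex P b, ∃ (w : V ≃ₗ[F] V) (hw : w ∈ sphericalWeylGroup P)
      (J : Finset ι) (hJ : J ⊆ b), c = cosetSimplex hw hJ := by
    rintro ⟨_, w, hw, J, hJ, rfl⟩
    exact ⟨w, hw, J, hJ, rfl⟩
  choose w hw J hJ hc using hex
  let φ : CoxeterSimplex P b → {K // K ∈ boundary P b 𝒜 (Set.range f)} := fun c =>
    ⟨cls hf (hw c) (hJ c), (hX.mem_boundary_iff hb hf).2 ⟨w c, hw c, J c, hJ c, rfl⟩⟩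
  have hrel : ∀ c d, Subrel (FaceAtInfinity P b 𝒜) (· ∈ boundary P b 𝒜 (Set.range f))
      (φ c) (φ d) ↔ CoxeterFace P b c d := by
    intro c d
    conv_rhs => rw [hc c, hc d]
    rw [coxeterFace_iff hb]
    exact hX.cls_face_cls_iff hb hf (hw c) (hw d) (hJ c) (hJ d)
  -- Independence of the chosen representatives: equal cosets give classes that are faces of each
  -- other.
  have hφ : ∀ (u : V ≃ₗ[F] V) (hu : u ∈ sphericalWeylGroup P) (K : Finset ι) (hK : K ⊆ b),
      (φ (cosetSimplex hu hK)).1 = cls hf hu hK := by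
    intro u hu K hK
    set c := cosetSimplex hu hK with hcc
    refine hX.face_antisymm hb ?_ ?_
    · rw [hX.cls_face_cls_iff hb hf, ← coxeterFace_iff hb (hw c) hu (hJ c) hK, ← hc c]
      exact subset_rfl
    · rw [hX.cls_face_cls_iff hb hf, ← coxeterFace_iff hb hu (hw c) hK (hJ c), ← hc c]
      exact subset_rfl
  have hinj : Function.Injective φ := fun c d h => by
    refine Subtype.ext (Set.Subset.antisymm ((hrel d c).1 ?_) ((hrel c d).1 ?_))
    · rw [h]; exact hX.face_refl hb _
    · rw [h]; exact hX.face_refl hb _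
  have hsurj : Function.Surjective φ := by
    rintro ⟨K, hK⟩
    obtain ⟨u, hu, L, hL, rfl⟩ := (hX.mem_boundary_iff hb hf).1 hK
    exact ⟨cosetSimplex hu hL, Subtype.ext (hφ u hu L hL)⟩
  exact ⟨⟨Equiv.ofBijective φ ⟨hinj, hsurj⟩, fun {c d} => hrel c d⟩, hφ⟩

/-- Once the common chamber has the same direction in both charts, sending each coset to itself
fixes all common simplices, since their position relative to that chamber is intrinsic. -/
lemma exists_iso_of_chamber (hX : IsAffineBuilding P b T 𝒜) (hb : IsBasis P b)
    {f f' : V ⊗[F] Λ → X} (hf : f ∈ 𝒜) (hf' : f' ∈ 𝒜) {w w' : V ≃ₗ[F] V}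
    (hw : w ∈ sphericalWeylGroup P) (hw' : w' ∈ sphericalWeylGroup P)
    (h : Parallel P b 𝒜 (cone P b f w 0 ∅) (cone P b f' w' 0 ∅)) :
    ∃ φ : Subrel (FaceAtInfinity P b 𝒜) (· ∈ boundary P b 𝒜 (Set.range f)) ≃r
        Subrel (FaceAtInfinity P b 𝒜) (· ∈ boundary P b 𝒜 (Set.range f')),
      ∀ z, z.1 ∈ boundary P b 𝒜 (Set.range f') → (φ z).1 = z.1 := by
  have hv := mul_mem hw' (inv_mem hw)
  -- Reparametrize the second apartment by A1, so that the common chamber has direction `w` in both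
  -- charts.
  set g : V ⊗[F] Λ → X := f' ∘ act (w' * w⁻¹) with hg_def
  have hg : g ∈ 𝒜 := hX.A1 f' hf' _ ⟨_, hv, 0, zero_mem T, fun x => (add_zero _).symm⟩
  have hr : Set.range g = Set.range f' :=
    Function.Surjective.range_comp (fun x => ⟨act (w' * w⁻¹)⁻¹ x, act_act_inv _ x⟩) f'
  have hc : cone P b g w 0 ∅ = cone P b f' w' 0 ∅ := by
    refine cone_congr (fun x _ => ?_) ∅
    rw [hg_def, Function.comp_apply, add_zero, add_zero, ← act_mul, inv_mul_cancel_right]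
  rw [← hc] at h
  rw [← hr]
  clear_value g
  obtain ⟨φ, hφ⟩ := hX.exists_coxeter_iso hb hf
  obtain ⟨ψ, hψ⟩ := hX.exists_coxeter_iso hb hg
  refine ⟨φ.symm.trans ψ, ?_⟩
  rintro ⟨z, hz⟩ hz'
  obtain ⟨u, hu, J, hJ, rfl⟩ := (hX.mem_boundary_iff hb hf).1 hz
  obtain ⟨u', hu', J', hJ', he⟩ := (hX.mem_boundary_iff hb hg).1 hz'
  have hp := (hX.cls_eq_iff hb hf hg hu hu' hJ hJ').1 he
  obtain rfl : J = J' := (hX.parallel_faces_of_dominated hb hg hf hu' hu hJ' hJ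
    (parallel_iff.1 hp).2).1.antisymm (hX.parallel_faces_of_dominated hb hf hg hu hu' hJ hJ'
    (parallel_iff.1 hp).1).1
  have hm := hX.mem_parabolic_of_parallel hb hf hg hw hw hu hu' hJ h hp
  rw [mul_inv_rev, inv_inv, mul_assoc, mul_inv_cancel_left] at hm
  have e : φ.symm ⟨cls hf hu hJ, hz⟩ = cosetSimplex hu hJ := by
    rw [RelIso.symm_apply_eq]
    exact Subtype.ext (hφ u hu J hJ).symm
  change cls hf hu hJ = cls hg hu' hJ' at he
  change (ψ (φ.symm _)).1 = cls hf hu hJ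
  rw [e, hψ, he, hX.cls_eq_iff hb hg hg, hX.cone_parallel_iff hb hg hu hu' hJ hJ]
  exact ⟨hm, rfl⟩

/-- Pass through a third apartment `g` that shares with `f` a chamber containing `x`, and with `f'`
a chamber containing `y`. All faces of `x` and `y` lie in the boundary of `g`, so both isomorphisms
fix them. -/
lemma exists_iso (hX : IsAffineBuilding P b T 𝒜) (hb : IsBasis P b)
    {f f' : V ⊗[F] Λ → X} (hf : f ∈ 𝒜) (hf' : f' ∈ 𝒜) {x y : SimplexAtInfinity P b 𝒜}
    (hx : x ∈ boundary P b 𝒜 (Set.range f)) (hx' : x ∈ boundary P b 𝒜 (Set.range f'))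
    (hy' : y ∈ boundary P b 𝒜 (Set.range f')) :
    ∃ φ : Subrel (FaceAtInfinity P b 𝒜) (· ∈ boundary P b 𝒜 (Set.range f)) ≃r
        Subrel (FaceAtInfinity P b 𝒜) (· ∈ boundary P b 𝒜 (Set.range f')),
      ∀ z, FaceAtInfinity P b 𝒜 z.1 x ∨ FaceAtInfinity P b 𝒜 z.1 y → (φ z).1 = z.1 := by
  obtain ⟨w, hw, J, hJ, ex⟩ := (hX.mem_boundary_iff hb hf).1 hx
  obtain ⟨w', hw', J', hJ', ey⟩ := (hX.mem_boundary_iff hb hf').1 hy'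
  have hE := Finset.empty_subset b
  obtain ⟨g, hg, u, hu, u', hu', h1, h2⟩ := hX.exists_common_cls hb hf hf' hw hw'
  have hxg := (hX.mem_boundary_iff hb hg).2 ⟨u, hu, J, hJ, ex.trans (h1 J hJ)⟩
  have hyg := (hX.mem_boundary_iff hb hg).2 ⟨u', hu', J', hJ', ey.trans (h2 J' hJ')⟩
  obtain ⟨φ, hφ⟩ := hX.exists_iso_of_chamber hb hf hg hw hu
    ((hX.cls_eq_iff hb hf hg hw hu hE hE).1 (h1 ∅ hE))
  obtain ⟨ψ, hψ⟩ := hX.exists_iso_of_chamber hb hg hf' hu' hw'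
    ((hX.cls_eq_iff hb hf' hg hw' hu' hE hE).1 (h2 ∅ hE)).symm
  refine ⟨φ.trans ψ, fun z hz => ?_⟩
  have hzg : z.1 ∈ boundary P b 𝒜 (Set.range g) := hz.elim
    (hX.boundary_subcomplex hb hg hxg) (hX.boundary_subcomplex hb hg hyg)
  have hzf : z.1 ∈ boundary P b 𝒜 (Set.range f') := hz.elim
    (hX.boundary_subcomplex hb hf' hx') (hX.boundary_subcomplex hb hf' hy')
  have e := hφ z hzg
  change (ψ (φ z)).1 = z.1
  rw [hψ _ (by rwa [e]), e]

lemma exists_glb (hX : IsAffineBuilding P b T 𝒜) (hb : IsBasis P b)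
    (x y : SimplexAtInfinity P b 𝒜) : ∃ z, ∀ u, FaceAtInfinity P b 𝒜 u z ↔
      FaceAtInfinity P b 𝒜 u x ∧ FaceAtInfinity P b 𝒜 u y := by
  classical
  obtain ⟨f, hf, hx, hy⟩ := hX.exists_common_boundary hb x y
  obtain ⟨w, hw, J, hJ, rfl⟩ := (hX.mem_boundary_iff hb hf).1 hx
  obtain ⟨w', hw', J', hJ', rfl⟩ := (hX.mem_boundary_iff hb hf).1 hy
  have hww := mul_mem (inv_mem hw) hw'
  -- The types of common faces, seen from `w`. This family contains `b`, the type of the empty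
  -- simplex, and is closed under intersection, so its member of least cardinality lies in all
  -- others.
  let s : Finset (Finset ι) :=
    b.powerset.filter fun K => J ⊆ K ∧ J' ⊆ K ∧ w⁻¹ * w' ∈ parabolic P K
  obtain ⟨K, hK, hmin⟩ := s.exists_min_image Finset.card
    ⟨b, Finset.mem_filter.2 ⟨Finset.mem_powerset_self b, hJ, hJ', by rwa [parabolic_eq hb]⟩⟩
  obtain ⟨hKb, hJK, hJK', hwK⟩ := Finset.mem_filter.1 hK
  rw [Finset.mem_powerset] at hKb
  refine ⟨cls hf hw hKb, fun u => ⟨fun hu => ⟨hX.face_trans hb hu ?_, hX.face_trans hb hu ?_⟩, ?_⟩⟩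
  · exact (hX.cls_face_cls_self_iff hb hf hw hKb hJ).2 hJK
  · exact (hX.cls_face_cls_iff hb hf hw hw' hKb hJ').2 ⟨hwK, hJK'⟩
  · rintro ⟨hux, huy⟩
    obtain ⟨L, hL, hJL, rfl⟩ := (hX.face_cls_iff hb hf hw hJ).1 hux
    obtain ⟨hwL, hJL'⟩ := (hX.cls_face_cls_iff hb hf hw hw' hL hJ').1 huy
    rw [hX.cls_face_cls_self_iff hb hf hw hL hKb]
    have hmem : K ∩ L ∈ s := Finset.mem_filter.2
      ⟨Finset.mem_powerset.2 (Finset.inter_subset_left.trans hKb), Finset.subset_inter hJK hJL,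
        Finset.subset_inter hJK' hJL', mem_parabolic_inter hb hKb hL hwK hwL⟩
    exact Finset.inter_eq_left.1
      (Finset.eq_of_subset_of_card_le Finset.inter_subset_left (hmin _ hmem))

lemma exists_boolean (hX : IsAffineBuilding P b T 𝒜) (hb : IsBasis P b)
    (x : SimplexAtInfinity P b 𝒜) : ∃ n : ℕ,
      Nonempty (Subrel (FaceAtInfinity P b 𝒜) (fun y => FaceAtInfinity P b 𝒜 y x) ≃r
        ((· ⊆ ·) : Finset (Fin n) → Finset (Fin n) → Prop)) := by
  classical
  obtain ⟨f, hf, w, hw, J, hJ, rfl⟩ := hX.exists_eq_cls hb x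
  let e : Fin (b \ J).card ↪ ι :=
    (b \ J).equivFin.symm.toEmbedding.trans (Function.Embedding.subtype _)
  have he : ∀ i, e i ∈ b \ J := fun i => ((b \ J).equivFin.symm i).2
  have he' : ∀ k ∈ b \ J, ∃ i, e i = k := fun k hk =>
    ⟨(b \ J).equivFin ⟨k, hk⟩, congrArg Subtype.val ((b \ J).equivFin.symm_apply_apply ⟨k, hk⟩)⟩
  have hsub : ∀ s : Finset (Fin (b \ J).card), b \ s.map e ⊆ b := fun s => Finset.sdiff_subset
  have hle : ∀ s : Finset (Fin (b \ J).card), J ⊆ b \ s.map e := fun s k hk => by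
    refine Finset.mem_sdiff.2 ⟨hJ hk, fun h => ?_⟩
    obtain ⟨i, -, rfl⟩ := Finset.mem_map.1 h
    exact (Finset.mem_sdiff.1 (he i)).2 hk
  -- Types are complementary to vertex sets: a larger type is a smaller face, so a set of vertices
  -- is sent to the face whose type is its complement in `b`.
  let ψ : Finset (Fin (b \ J).card) →
      {y : SimplexAtInfinity P b 𝒜 // FaceAtInfinity P b 𝒜 y (cls hf hw hJ)} := fun s =>
    ⟨cls hf hw (hsub s), (hX.cls_face_cls_self_iff hb hf hw (hsub s) hJ).2 (hle s)⟩
  have hrel : ∀ s t, FaceAtInfinity P b 𝒜 (ψ s).1 (ψ t).1 ↔ s ⊆ t := by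
    intro s t
    rw [hX.cls_face_cls_self_iff hb hf hw (hsub s) (hsub t)]
    constructor
    · intro h i hi
      by_contra hit
      have h1 : e i ∈ b \ t.map e := Finset.mem_sdiff.2
        ⟨(Finset.mem_sdiff.1 (he i)).1, by rwa [Finset.mem_map' e]⟩
      exact (Finset.mem_sdiff.1 (h h1)).2 (Finset.mem_map_of_mem e hi)
    · intro h
      exact Finset.sdiff_subset_sdiff subset_rfl (Finset.map_subset_map.2 h)
  have hinj : Function.Injective ψ := fun s t h => by
    refine Finset.Subset.antisymm ((hrel s t).1 ?_) ((hrel t s).1 ?_)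
    · rw [h]; exact hX.face_refl hb _
    · rw [h]; exact hX.face_refl hb _
  have hsurj : Function.Surjective ψ := by
    rintro ⟨y, hy⟩
    obtain ⟨K, hK, hJK, rfl⟩ := (hX.face_cls_iff hb hf hw hJ).1 hy
    refine ⟨Finset.univ.filter fun i => e i ∉ K, Subtype.ext ?_⟩
    have hKe : b \ (Finset.univ.filter fun i => e i ∉ K).map e = K := by
      ext k
      rw [Finset.mem_sdiff, Finset.mem_map]
      constructor
      · rintro ⟨hk, h⟩
        by_contra hkK
        obtain ⟨i, rfl⟩ := he' k (Finset.mem_sdiff.2 ⟨hk, fun h => hkK (hJK h)⟩)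
        exact h ⟨i, Finset.mem_filter.2 ⟨Finset.mem_univ _, hkK⟩, rfl⟩
      · intro hk
        refine ⟨hK hk, ?_⟩
        rintro ⟨i, hi, rfl⟩
        exact (Finset.mem_filter.1 hi).2 hk
    change cls hf hw (hsub _) = cls hf hw hK
    congr 1
  exact ⟨_, ⟨RelIso.symm ⟨Equiv.ofBijective ψ ⟨hinj, hsurj⟩, fun {s t} => hrel s t⟩⟩⟩

lemma isSphericalBuilding [Nonempty X] (hX : IsAffineBuilding P b T 𝒜) (hb : IsBasis P b) :
    IsSphericalBuilding P b (FaceAtInfinity P b 𝒜) (apartmentsAtInfinity P b 𝒜) where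
  spherical := finite_sphericalWeylGroup P
  simplicial :=
    { nonempty := by
        obtain ⟨f, hf, -⟩ := hX.A3 (Classical.arbitrary X) (Classical.arbitrary X)
        exact ⟨cls hf (one_mem _) (Finset.empty_subset b)⟩
      refl := hX.face_refl hb
      trans := fun _ _ _ => hX.face_trans hb
      antisymm := fun _ _ => hX.face_antisymm hb
      exists_glb := hX.exists_glb hb
      boolean := hX.exists_boolean hb }
  subcomplex := by
    rintro _ ⟨_, ⟨f, hf, rfl⟩, rfl⟩ x hx y hy
    exact hX.boundary_subcomplex hb hf hx hy
  coxeter := by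
    rintro _ ⟨_, ⟨f, hf, rfl⟩, rfl⟩
    obtain ⟨φ, -⟩ := hX.exists_coxeter_iso hb hf
    exact ⟨φ.symm⟩
  common_apartment := fun x y => by
    obtain ⟨f, hf, h⟩ := hX.exists_common_boundary hb x y
    exact ⟨_, ⟨_, ⟨f, hf, rfl⟩, rfl⟩, h⟩
  exists_iso := by
    rintro _ ⟨_, ⟨f, hf, rfl⟩, rfl⟩ _ ⟨_, ⟨f', hf', rfl⟩, rfl⟩ x ⟨hx, hx'⟩ y ⟨-, hy'⟩
    exact hX.exists_iso hb hf hf' hx hx' hy'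

/-! ### Chambers, adjacency and apartments at infinity -/

lemma isChamberAtInfinity_iff (hX : IsAffineBuilding P b T 𝒜) (hb : IsBasis P b)
    {K : SimplexAtInfinity P b 𝒜} : IsChamberAtInfinity P b 𝒜 K ↔
      ∃ (f : V ⊗[F] Λ → X) (hf : f ∈ 𝒜) (w : V ≃ₗ[F] V) (hw : w ∈ sphericalWeylGroup P),
        K = cls hf hw (Finset.empty_subset b) := by
  constructor
  · rintro ⟨S, hS, hK⟩
    obtain ⟨f, hf, w, hw, t, rfl⟩ := isWeylChamber_iff.1 hS
    refine ⟨f, hf, w, hw, hX.eq_cls_of_mem hb hf hw _ (t := t) ?_⟩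
    rw [hK]
    exact ⟨isWeylSimplex_iff.2 ⟨f, hf, w, hw, t, ∅, Finset.empty_subset b, rfl⟩,
      hX.parallel_refl hb _⟩
  · rintro ⟨f, hf, w, hw, rfl⟩
    exact ⟨_, isWeylChamber_iff.2 ⟨f, hf, w, hw, 0, rfl⟩, rfl⟩

lemma isChamberAtInfinity_iff_maximal (hX : IsAffineBuilding P b T 𝒜) (hb : IsBasis P b)
    (K : SimplexAtInfinity P b 𝒜) : IsChamberAtInfinity P b 𝒜 K ↔
      ∀ L, FaceAtInfinity P b 𝒜 K L → L = K := by
  have hE := Finset.empty_subset b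
  constructor
  · intro h L hL
    obtain ⟨f, hf, w, hw, rfl⟩ := (hX.isChamberAtInfinity_iff hb).1 h
    obtain ⟨g, hg, u, hu, J, hJ, rfl⟩ := hX.exists_eq_cls hb L
    rw [hX.faceAtInfinity_iff hb] at hL
    obtain ⟨h1, h2⟩ := hX.parallel_faces_of_dominated hb hf hg hw hu hE hJ hL
    obtain rfl := Finset.subset_empty.1 h1
    exact ((hX.cls_eq_iff hb hf hg hw hu hE hJ).2 (h2 ∅ hE subset_rfl)).symm
  · intro h
    obtain ⟨f, hf, w, hw, J, hJ, rfl⟩ := hX.exists_eq_cls hb K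
    have := h (cls hf hw hE) ((hX.cls_face_cls_self_iff hb hf hw hJ hE).2 (Finset.empty_subset J))
    exact (hX.isChamberAtInfinity_iff hb).2 ⟨f, hf, w, hw, this.symm⟩

lemma adjacentAtInfinity_iff (hX : IsAffineBuilding P b T 𝒜) (hb : IsBasis P b)
    (K L : SimplexAtInfinity P b 𝒜) (hK : IsChamberAtInfinity P b 𝒜 K)
    (hL : IsChamberAtInfinity P b 𝒜 L) :
    AdjacentAtInfinity P b 𝒜 K L ↔ K ≠ L ∧ ∃ M, M ≠ K ∧ M ≠ L ∧
      FaceAtInfinity P b 𝒜 M K ∧ FaceAtInfinity P b 𝒜 M L ∧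
      (∀ M', FaceAtInfinity P b 𝒜 M M' → FaceAtInfinity P b 𝒜 M' K → M' = M ∨ M' = K) := by
  have hE := Finset.empty_subset b
  have hne : ∀ {f : V ⊗[F] Λ → X} (hf : f ∈ 𝒜) {w : V ≃ₗ[F] V} (hw : w ∈ sphericalWeylGroup P)
      {j : ι} (hj : {j} ⊆ b), (cls hf hw hj : SimplexAtInfinity P b 𝒜) ≠ cls hf hw hE := by
    intro f hf w hw j hj h
    have := hX.face_refl hb (cls hf hw hE)
    nth_rewrite 2 [← h] at this
    rw [hX.cls_face_cls_self_iff hb hf hw hE hj] at this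
    exact Finset.notMem_empty j (this (Finset.mem_singleton_self j))
  constructor
  · rintro ⟨S₁, h1, S₂, h2, hS, f, hf, g, ⟨w, hw, t, -, hg⟩, h, ⟨w', hw', t', -, hh⟩, rfl, rfl,
      hgh, j, hj, k, hk, hjk⟩
    rw [hg, hh, map_zero, map_zero, zero_add, zero_add] at hgh
    subst hgh
    have hjk := congrArg (f '' ·) hjk
    simp only [← fundFace_empty, image_image_fundFace f hg, image_image_fundFace f hh]
      at h1 h2 hS hjk
    have hjb := Finset.singleton_subset_iff.2 hj
    have hkb := Finset.singleton_subset_iff.2 hk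
    obtain rfl := hX.eq_cls_of_mem hb hf hw hE h1
    obtain rfl := hX.eq_cls_of_mem hb hf hw' hE h2
    have hM : (cls hf hw hjb : SimplexAtInfinity P b 𝒜) = cls hf hw' hkb := by
      refine hX.eq_cls_of_mem hb hf hw' hkb (t := t) ?_
      rw [← hjk, mem_cls_iff hf hf hw hw hjb hjb t]
      exact hX.parallel_translate hb hf hw hjb 0 t
    refine ⟨fun he => hS ?_, cls hf hw hjb, hne hf hw hjb, ?_, ?_, ?_, ?_⟩
    · have := ((hX.cone_parallel_iff hb hf hw hw' hE hE 0 0).1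
        ((hX.cls_eq_iff hb hf hf hw hw' hE hE).1 he)).1
      rw [parabolic_empty, Subgroup.mem_bot, inv_mul_eq_one] at this
      rw [this]
    · rw [hM]; exact hne hf hw' hkb
    · exact (hX.cls_face_cls_self_iff hb hf hw hjb hE).2 (Finset.empty_subset _)
    · rw [hM]; exact (hX.cls_face_cls_self_iff hb hf hw' hkb hE).2 (Finset.empty_subset _)
    · intro M' h3 h4
      obtain ⟨J, hJ, -, rfl⟩ := (hX.face_cls_iff hb hf hw hE).1 h4
      rw [hX.cls_face_cls_self_iff hb hf hw hjb hJ, Finset.subset_singleton_iff] at h3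
      rcases h3 with rfl | rfl
      · exact Or.inr rfl
      · exact Or.inl rfl
  · rintro ⟨hKL, M, hMK, -, h1, h2, h3⟩
    obtain ⟨f₁, hf₁, w₁, hw₁, rfl⟩ := (hX.isChamberAtInfinity_iff hb).1 hK
    obtain ⟨f₂, hf₂, w₂, hw₂, rfl⟩ := (hX.isChamberAtInfinity_iff hb).1 hL
    obtain ⟨f, hf, w, hw, w', hw', e1, e2⟩ := hX.exists_common_cls hb hf₁ hf₂ hw₁ hw₂
    rw [e1] at hKL hMK h1 h3 ⊢
    rw [e2] at hKL h2 ⊢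
    obtain ⟨J, hJ, -, rfl⟩ := (hX.face_cls_iff hb hf hw hE).1 h1
    have hJne : J.Nonempty := by
      rw [Finset.nonempty_iff_ne_empty]
      rintro rfl
      exact hMK rfl
    obtain ⟨j, hj⟩ := hJne
    have hjb := Finset.singleton_subset_iff.2 (hJ hj)
    have hM := (h3 (cls hf hw hjb)
      ((hX.cls_face_cls_self_iff hb hf hw hJ hjb).2 (Finset.singleton_subset_iff.2 hj))
      ((hX.cls_face_cls_self_iff hb hf hw hjb hE).2 (Finset.empty_subset _))).resolve_right
      (hne hf hw hjb)
    rw [← hM, hX.cls_face_cls_iff hb hf hw hw' hjb hE] at h2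
    refine ⟨_, hX.mem_cls_self hb hf hw hE, _, hX.mem_cls_self hb hf hw' hE, ?_, f, hf, _,
      affine_mem_fullAffineWeylGroup hw 0, _, affine_mem_fullAffineWeylGroup hw' 0, ?_, ?_, ?_,
      j, hJ hj, j, hJ hj, ?_⟩
    · intro he
      refine hKL ((hX.cls_eq_iff hb hf hf hw hw' hE hE).2 ?_)
      rw [he]
      exact hX.parallel_refl hb _
    · rw [← fundFace_empty, image_image_fundFace f fun _ => rfl]
    · rw [← fundFace_empty, image_image_fundFace f fun _ => rfl]
    · simp only [map_zero]
    -- The two directions differ by an element of the parabolic subgroup of `{j}`, which fixes the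
    -- panel pointwise.
    · refine Set.image_congr fun x hx => ?_
      conv_lhs => rw [← act_eq_self_of_mem_fundFace hb hjb h2.1 hx, ← act_mul,
        mul_inv_cancel_left]

lemma range_subset_of_boundary_subset (hX : IsAffineBuilding P b T 𝒜) (hb : IsBasis P b)
    {f f' : V ⊗[F] Λ → X} (hf : f ∈ 𝒜) (hf' : f' ∈ 𝒜)
    (h : boundary P b 𝒜 (Set.range f) ⊆ boundary P b 𝒜 (Set.range f')) :
    Set.range f ⊆ Set.range f' := by
  have hE := Finset.empty_subset b
  have key : ∀ w : V ≃ₗ[F] V, ∃ t, w ∈ sphericalWeylGroup P →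
      ∀ x ∈ (fundChamber P b : Set (V ⊗[F] Λ)), f (act w x + t) ∈ Set.range f' := by
    intro w
    by_cases hw : w ∈ sphericalWeylGroup P
    · obtain ⟨w', hw', J, hJ, he⟩ := (hX.mem_boundary_iff hb hf').1
        (h ((hX.mem_boundary_iff hb hf).2 ⟨w, hw, ∅, hE, rfl⟩))
      rw [hX.cls_eq_iff hb] at he
      obtain ⟨h1, h2⟩ := hX.parallel_faces_of_dominated hb hf hf' hw hw' hE hJ
        (parallel_iff.1 he).1
      obtain ⟨t, t', ht⟩ := hX.exists_common_subchamber hb hf hf' hw hw' (h2 ∅ hE subset_rfl)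
      exact ⟨t, fun _ x hx => ⟨_, (ht x hx).symm⟩⟩
    · exact ⟨0, fun h => absurd h hw⟩
  choose t ht using key
  have hint : (Set.range f ∩ Set.range f').Nonempty :=
    ⟨_, ⟨_, rfl⟩, ht 1 (one_mem _) 0 (zero_mem_fundFace P b ∅).1⟩
  -- The overlap is an intersection of half-apartments and contains a subchamber in each direction.
  -- Any member of `𝓗` would contain all of these, which is impossible, so `𝓗` is empty.
  obtain ⟨⟨𝓗, -, hspec, hY⟩, -⟩ := hX.A2 f hf f' hf' hint
  rintro _ ⟨x, rfl⟩
  change x ∈ f ⁻¹' Set.range f'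
  rw [hY]
  intro H hH
  obtain ⟨i, l, -, rfl⟩ := hspec H hH
  obtain ⟨w, hw, y, hy, hn⟩ := exists_notMem_halfApartment hb i l t
  have hmem : act w y + t w ∈ f ⁻¹' Set.range f' := ht w hw y hy
  rw [hY] at hmem
  exact absurd (hmem _ hH) hn

end IsAffineBuilding

end Infinity

end AffBuilding

end

theorem mainTheorem8 {F : Subfield ℝ} {ι V V' Λ X : Type*} [Fintype ι]
    [AddCommGroup V] [Module F V] [AddCommGroup V'] [Module F V']
    [AddCommGroup Λ] [LinearOrder Λ] [IsOrderedAddMonoid Λ] [Module F Λ] [PosSMulMono F Λ]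
    [Nonempty X]
    (P : RootPairing ι F V V') [P.IsRootSystem]
    (b : Finset ι) (hb : AffBuilding.IsBasis P b)
    (T : AddSubgroup (V ⊗[F] Λ)) (hT : T ≠ ⊥)
    (hTW : ∀ w ∈ AffBuilding.sphericalWeylGroup P, ∀ t ∈ T, AffBuilding.act w t ∈ T)
    (𝒜 : Set (V ⊗[F] Λ → X)) (hX : AffBuilding.IsAffineBuilding P b T 𝒜) :
    AffBuilding.IsSphericalBuilding P b (AffBuilding.FaceAtInfinity P b 𝒜)
        (AffBuilding.apartmentsAtInfinity P b 𝒜) ∧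
      (∀ K, AffBuilding.IsChamberAtInfinity P b 𝒜 K ↔
        ∀ L, AffBuilding.FaceAtInfinity P b 𝒜 K L → L = K) ∧
      (∀ K L, AffBuilding.IsChamberAtInfinity P b 𝒜 K → AffBuilding.IsChamberAtInfinity P b 𝒜 L →
        (AffBuilding.AdjacentAtInfinity P b 𝒜 K L ↔
          K ≠ L ∧ ∃ M, M ≠ K ∧ M ≠ L ∧
            AffBuilding.FaceAtInfinity P b 𝒜 M K ∧ AffBuilding.FaceAtInfinity P b 𝒜 M L ∧
            (∀ M', AffBuilding.FaceAtInfinity P b 𝒜 M M' →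
              AffBuilding.FaceAtInfinity P b 𝒜 M' K → M' = M ∨ M' = K))) ∧
      Set.BijOn (AffBuilding.boundary P b 𝒜) (AffBuilding.apartments 𝒜)
        (AffBuilding.apartmentsAtInfinity P b 𝒜) := by
  -- If `Λ` were trivial, the model space would be zero, leaving no room for a non-zero `T`.
  have : Nontrivial Λ := by
    by_contra h
    rw [not_nontrivial_iff_subsingleton] at h
    refine hT ((AddSubgroup.eq_bot_iff_forall T).2 fun x _ => ?_)
    rw [AffBuilding.eq_sum_coweight_tmul hb x]
    refine Finset.sum_eq_zero fun k _ => ?_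
    rw [Subsingleton.elim (AffBuilding.evalCoroot P Λ k x) 0, TensorProduct.tmul_zero]
  refine ⟨hX.isSphericalBuilding hb, hX.isChamberAtInfinity_iff_maximal hb,
    hX.adjacentAtInfinity_iff hb, fun A hA => ⟨A, hA, rfl⟩, ?_, ?_⟩
  · rintro _ ⟨f, hf, rfl⟩ _ ⟨f', hf', rfl⟩ h
    exact (hX.range_subset_of_boundary_subset hb hf hf' h.le).antisymm
      (hX.range_subset_of_boundary_subset hb hf' hf h.ge)
  · rintro _ ⟨A, hA, rfl⟩
    exact ⟨A, hA, rfl⟩
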